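/- For a group $G$ let $R(G)=\operatorname{Hom}(G,SU(2))/SU(2)$ be the space of $SU(2)$-representations of $G$ up to conjugation (the quotient topology of the topology of pointwise convergence), and let $R(G)^*\subset R(G)$ be the set of classes of irreducible representations (those for which $\mathbb{C}^2$ has no proper non-zero invariant subspace). The space $R(T^2):=R(\pi_1(T^2))$ is called the pillowcase; given generators $m,l$ of $\pi_1(T^2)\cong\mathbb{Z}^2$, a point of it has coordinates $(\alpha,\beta)$ if it is represented by some $\rho$ with $\rho(m)=\operatorname{diag}(e^{i\alpha},e^{-i\alpha})$ and $\rho(l)=\operatorname{diag}(e^{i\beta},e^{-i\beta})$. Let $Y$ be an integer homology three-sphere (a closed connected three-manifold with $H_*(Y;\mathbb{Z})\cong H_*(S^3;\mathbb{Z})$) that is $SU(2)$-cyclic, i.e. every homomorphism $\pi_1(Y)\to SU(2)$ is trivial. Let $K\subset Y$ be a knot with closed tubular neighborhood $N(K)\cong S^1\times D^2$, let $Y(K)=Y\setminus N(K)^\circ$ be its exterior, and let $i^*\colon R(\pi_1(Y(K)))\to R(T^2)$ be the map that restricts representations to the boundary torus $T^2\cong\partial N(K)$, where the first pillowcase coordinate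 corresponds to the meridian $m$ of $K$ and the second one to the longitude $l$ of $K$ (the curve on $\partial N(K)$ that is parallel to $K$ in $N(K)$ and null-homologous in $Y(K)$). Then there is an open subset $U$ of the pillowcase $R(T^2)$ that contains both lines $\{\alpha = 0 \bmod 2\pi\mathbb{Z}\}$ and $\{\alpha=\pi \bmod 2\pi\mathbb{Z}\}$ and is disjoint from $i^*\big(R(\pi_1(Y(K)))^*\big)$. -/

import Mathlib

open scoped Matrix Topology
open CategoryTheory

universe u

noncomputable section

/-! ### Integer homology three-spheres -/

/-- The `k`-th singular homology group of `Y` with integer coefficients. -/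
def integralHomology (Y : Type u) [TopologicalSpace Y] (k : ℕ) : ModuleCat.{u} ℤ :=
  ((AlgebraicTopology.singularHomologyFunctor (ModuleCat.{u} ℤ) k).obj
    (ModuleCat.of ℤ (ULift.{u} ℤ))).obj (TopCat.of Y)

/-- `Y` has the integral singular homology of the three-sphere: `H₀ ≅ H₃ ≅ ℤ`, and all the other
homology groups vanish. -/
structure HasHomologyOfThreeSphere (Y : Type u) [TopologicalSpace Y] : Prop where
  iso_int : ∀ k : ℕ, k = 0 ∨ k = 3 →
    Nonempty (integralHomology Y k ≅ ModuleCat.of ℤ (ULift.{u} ℤ))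
  isZero : ∀ k : ℕ, k ≠ 0 → k ≠ 3 → Limits.IsZero (integralHomology Y k)

/-- An integer homology three-sphere: a closed (compact, without boundary) connected
three-manifold whose integral homology is that of the three-sphere. -/
structure IsIntegerHomologyThreeSphere (Y : Type u) [TopologicalSpace Y] : Prop where
  t2 : T2Space Y
  compact : CompactSpace Y
  connected : ConnectedSpace Y
  manifold : Nonempty (ChartedSpace (EuclideanSpace ℝ (Fin 3)) Y)
  homology : HasHomologyOfThreeSphere Y

/-! ### Representation spaces in SU(2) -/

/-- The group `SU(2)`, with the subspace topology from the complex two by two matrices. -/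
abbrev SU2 : Type := Matrix.specialUnitaryGroup (Fin 2) ℂ

/-- The diagonal matrix with entries `exp (i θ)` and `exp (- i θ)`, as an element of `SU(2)`. -/
def diagSU2 (θ : ℝ) : SU2 :=
  ⟨!![Complex.exp (θ * Complex.I), 0; 0, Complex.exp (-(θ * Complex.I))], by
    rw [Matrix.mem_specialUnitaryGroup_iff, Matrix.mem_unitaryGroup_iff]
    constructor
    · ext i j
      fin_cases i <;> fin_cases j <;>
        simp [Matrix.mul_apply, Matrix.star_apply, ← Complex.exp_conj, ← Complex.exp_add]
    · simp [Matrix.det_fin_two, ← Complex.exp_add]⟩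

/-- The topology of pointwise convergence on `Hom(G, SU(2))`. -/
instance SU2Hom.instTopologicalSpace (G : Type*) [Group G] : TopologicalSpace (G →* SU2) :=
  TopologicalSpace.induced (fun ρ : G →* SU2 => (ρ : G → SU2)) inferInstance

/-- Two representations are equivalent when they are conjugate by an element of `SU(2)`. -/
def SU2Hom.setoid (G : Type*) [Group G] : Setoid (G →* SU2) where
  r ρ σ := ∃ u : SU2, ∀ g : G, σ g = u * ρ g * u⁻¹
  iseqv :=
    { refl := fun ρ => ⟨1, fun g => by simp⟩
      symm := by
        rintro ρ σ ⟨u, hu⟩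
        exact ⟨u⁻¹, fun g => by rw [hu g]; group⟩
      trans := by
        rintro ρ σ τ ⟨u, hu⟩ ⟨v, hv⟩
        exact ⟨v * u, fun g => by rw [hv g, hu g]; group⟩ }

/-- The space `Hom(G, SU(2)) / SU(2)` of representations up to conjugation. -/
def RepSpace (G : Type*) [Group G] : Type _ := Quotient (SU2Hom.setoid G)

/-- `Hom(G, SU(2)) / SU(2)` carries the quotient topology. -/
instance RepSpace.instTopologicalSpace (G : Type*) [Group G] : TopologicalSpace (RepSpace G) :=
  inferInstanceAs (TopologicalSpace (Quotient (SU2Hom.setoid G)))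

/-- The conjugacy class of a representation. -/
def RepSpace.mk {G : Type*} [Group G] (ρ : G →* SU2) : RepSpace G :=
  Quotient.mk (SU2Hom.setoid G) ρ

/-- The map `Hom(G, SU(2)) / SU(2) → Hom(H, SU(2)) / SU(2)` given by composition with `f`. -/
def RepSpace.restrict {G H : Type*} [Group G] [Group H] (f : H →* G) :
    RepSpace G → RepSpace H :=
  Quotient.map' (s₁ := SU2Hom.setoid G) (s₂ := SU2Hom.setoid H) (fun ρ => ρ.comp f) (by
    rintro ρ σ ⟨u, hu⟩
    exact ⟨u, fun h => hu (f h)⟩)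

/-- The linear representation on `ℂ²` underlying a homomorphism to `SU(2)`. -/
def SU2Hom.toRepresentation {G : Type*} [Group G] (ρ : G →* SU2) :
    Representation ℂ G (Fin 2 → ℂ) :=
  ((Matrix.toLinAlgEquiv' : Matrix (Fin 2) (Fin 2) ℂ ≃ₐ[ℂ] _) : _ →* _).comp
    ((Matrix.specialUnitaryGroup (Fin 2) ℂ).subtype.comp ρ)

/-- The set of classes of irreducible representations in `Hom(G, SU(2)) / SU(2)`. -/
def RepSpace.irreducibles (G : Type*) [Group G] : Set (RepSpace G) :=
  RepSpace.mk '' {ρ : G →* SU2 | (SU2Hom.toRepresentation ρ).IsIrreducible}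

/-- A space is `SU(2)`-cyclic here if every `SU(2)`-representation of its fundamental group is
trivial. -/
def IsSU2Cyclic (Y : Type u) [TopologicalSpace Y] : Prop :=
  ∀ (y : Y) (ρ : FundamentalGroup Y y →* SU2), ρ = 1

/-! ### The pillowcase -/

/-- The fundamental group of the torus `S¹ × S¹`, based at `(1, 1)`. -/
abbrev TorusGroup : Type := FundamentalGroup (Circle × Circle) (1, 1)

/-- The pillowcase: the space of `SU(2)`-representations of the fundamental group of the torus,
up to conjugation. -/
abbrev Pillowcase : Type := RepSpace TorusGroup

/-- The loop `t ↦ (exp (2 π i p t), exp (2 π i q t))` on the torus. -/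
def torusLoop (p q : ℤ) : Path ((1, 1) : Circle × Circle) (1, 1) where
  toFun t := (Circle.exp (2 * Real.pi * p * t), Circle.exp (2 * Real.pi * q * t))
  continuous_toFun := by fun_prop
  source' := by simp
  target' := by
    have h : ∀ n : ℤ, Circle.exp (2 * Real.pi * n) = 1 := fun n => by
      rw [mul_comm]; exact Circle.exp_int_mul_two_pi n
    simp [h]

/-- The class of `torusLoop p q` in the fundamental group of the torus. -/
def torusClass (p q : ℤ) : TorusGroup :=
  FundamentalGroup.fromPath (Path.Homotopic.Quotient.mk (torusLoop p q))

/-- The point `x` of the pillowcase has coordinates `(α, β)` with respect to the generators `m, l`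
of the fundamental group of the torus: up to conjugation, the representation sends `m` to
`diag (exp (i α), exp (- i α))` and `l` to `diag (exp (i β), exp (- i β))`. -/
def Pillowcase.HasCoordinates (m l : TorusGroup) (x : Pillowcase) (α β : ℝ) : Prop :=
  ∃ ρ : TorusGroup →* SU2, RepSpace.mk ρ = x ∧ ρ m = diagSU2 α ∧ ρ l = diagSU2 β

/-- The line `{α = a mod 2πℤ}` in the pillowcase. -/
def Pillowcase.line (m l : TorusGroup) (a : ℝ) : Set Pillowcase :=
  {x | ∃ α β : ℝ, Pillowcase.HasCoordinates m l x α β ∧ ∃ k : ℤ, α = a + 2 * Real.pi * k}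

/-! ### Knots and their exteriors -/

/-- A knot: an embedded circle. Tameness is expressed by a tubular neighborhood, see below. -/
structure Knot (Y : Type u) [TopologicalSpace Y] where
  toFun : Circle → Y
  isEmbedding : Topology.IsEmbedding toFun

/-- A tubular neighborhood of a knot, parametrized by `S¹ × ℂ`. The closed tubular neighborhood
`N(K)` is the image of the product of `S¹` with the closed unit disk. -/
structure TubularNbhd {Y : Type u} [TopologicalSpace Y] (K : Knot Y) where
  toFun : Circle × ℂ → Y
  isOpenEmbedding : Topology.IsOpenEmbedding toFun
  core : ∀ z : Circle, toFun (z, 0) = K.toFun z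

namespace TubularNbhd

variable {Y : Type u} [TopologicalSpace Y] {K : Knot Y} (N : TubularNbhd K)

/-- The knot exterior `Y(K)`: the complement of the interior of `N(K)`. -/
def exterior : Set Y := (N.toFun '' {p | ‖p.2‖ < 1})ᶜ

theorem mem_exterior (p : Circle × Circle) : N.toFun (p.1, (p.2 : ℂ)) ∈ N.exterior := by
  rintro ⟨q, hq, h⟩
  have hlt : ‖q.2‖ < 1 := hq
  rw [N.isOpenEmbedding.injective h, Circle.norm_coe] at hlt
  exact lt_irrefl _ hlt

/-- The inclusion of the torus `∂N(K)`, identified with `S¹ × S¹`, into the knot exterior. -/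
def boundaryInclusion : C(Circle × Circle, N.exterior) where
  toFun p := ⟨N.toFun (p.1, (p.2 : ℂ)), N.mem_exterior p⟩
  continuous_toFun :=
    (N.isOpenEmbedding.continuous.comp (by fun_prop)).subtype_mk _

/-- The fundamental group of the knot exterior, based at a point of the boundary torus. -/
abbrev exteriorGroup : Type u :=
  FundamentalGroup N.exterior (N.boundaryInclusion (1, 1))

/-- The homomorphism of fundamental groups induced by the inclusion of the boundary torus. -/
def peripheral : TorusGroup →* N.exteriorGroup :=
  FundamentalGroup.map N.boundaryInclusion (1, 1)

/-- The map `i^* : R(K) → R(T²)` that restricts a representation to the boundary torus. -/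
def toPillowcase : RepSpace N.exteriorGroup → Pillowcase :=
  RepSpace.restrict N.peripheral

/-- The meridian of the knot: it bounds a fibre disk of `N(K)`. -/
def meridian (_N : TubularNbhd K) : TorusGroup := torusClass 0 1

/-- `l` is a longitude of the knot: a curve on `∂N(K)` that is parallel to the knot in `N(K)` and
null-homologous in the exterior, i.e. a product of commutators in its fundamental group. -/
def IsLongitude (l : TorusGroup) : Prop :=
  (∃ n : ℤ, l = torusClass 1 n) ∧ N.peripheral l ∈ commutator N.exteriorGroup

end TubularNbhd

end

/-! The lines α = 0 and α = π are the loci where the meridian m is sent to 1 or -1. The claim is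
therefore that ρ(m) stays uniformly away from ±1 as ρ runs over the irreducible representations of
the knot group G. Since Hom(G, SU(2)) is compact, it suffices that each ρ₀ with ρ₀(m) = ±1 has a
neighborhood of representations with commutative, hence reducible, image.

Such a ρ₀ is central (`mem_center_of_meridian`). Modulo the center of SU(2) it kills m, so it
extends over the solid torus to π₁(Y). The obstruction to lifting the extension to SU(2) is a class
in H² of Y with coefficients in the center, which vanishes because H₁ = H₂ = 0, and the lift is
trivial because Y is SU(2)-cyclic. The extension alone, without quotient and lift, shows that a
representation killing m is trivial (`eq_one_of_meridian`). Applied to characters with values in ℚ/ℤ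
⊂ SU(2), this says that m generates the abelianization of G (`exists_mul_zpow_mem_commutator`).

Division by ρ₀ moves the problem to a neighborhood of the trivial representation. G is finitely
generated (`exteriorGroup_fg`), hence generated by m and finitely many c_i in [G, G]. Put δ(ρ) = Σ
‖ρ(c_i) - 1‖. Every ρ(g) is O(δ)-close to a power of ρ(m), and powers of ρ(m) commute, so products
of commutators are o(1)·δ-close to 1 as ρ → 1. Thus δ ≤ o(1)·δ, which forces δ = 0, and the image is
generated by ρ(m) (`eventually_mem_zpowers`).

Extension over Y, lifting and finite generation are all handled with path cocycles: group-valued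
functions of curves that are multiplicative on triangles. On continuous curves they amount to
functors on the fundamental groupoid. They need no base point, glue along open covers
(`exists_isPathCocycleOn_univ`), and give 1-cochains on the singular set. -/

noncomputable section

/-! ### Path cocycles -/

/-- The curve obtained by restricting `g` to the segment from `p` to `q`. -/
def segCurve {X : Type*} (g : ℝ × ℝ → X) (p q : ℝ × ℝ) : unitInterval → X :=
  fun t => g (AffineMap.lineMap p q (t : ℝ))

/-- A function on curves that is multiplicative along the boundaries of the triangles in `U`. -/
def IsPathCocycleOn {X H : Type*} [TopologicalSpace X] [Group H] (U : Set X)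
    (Φ : (unitInterval → X) → H) : Prop :=
  ∀ (B : Set (ℝ × ℝ)) (g : ℝ × ℝ → X), Convex ℝ B → ContinuousOn g B → Set.MapsTo g B U →
    ∀ p ∈ B, ∀ q ∈ B, ∀ r ∈ B,
      Φ (segCurve g q r) * Φ (segCurve g p q) = Φ (segCurve g p r)

section PathCocycle

variable {X Y H : Type*} [TopologicalSpace X] [TopologicalSpace Y] [Group H]

theorem lineMap_mem_of_convex {B : Set (ℝ × ℝ)} (hB : Convex ℝ B) {p q : ℝ × ℝ} (hp : p ∈ B)
    (hq : q ∈ B) (t : unitInterval) : AffineMap.lineMap p q (t : ℝ) ∈ B :=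
  hB.lineMap_mem hp hq t.2

theorem continuous_segCurve {B : Set (ℝ × ℝ)} {g : ℝ × ℝ → X} (hB : Convex ℝ B)
    (hg : ContinuousOn g B) {p q : ℝ × ℝ} (hp : p ∈ B) (hq : q ∈ B) :
    Continuous (segCurve g p q) :=
  hg.comp_continuous (by fun_prop) (lineMap_mem_of_convex hB hp hq)

namespace IsPathCocycleOn

variable {U : Set X} {Φ : (unitInterval → X) → H}

theorem comp {V : Set Y} (h : IsPathCocycleOn U Φ) {r : Y → X} (hr : ContinuousOn r V)
    (hm : Set.MapsTo r V U) : IsPathCocycleOn V (fun c => Φ (r ∘ c)) :=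
  fun B g hB hg hgm => h B (r ∘ g) hB (hr.comp hg hgm) (hm.comp hgm)

theorem gauge (h : IsPathCocycleOn U Φ) (κ : X → H) :
    IsPathCocycleOn U (fun c => (κ (c 1))⁻¹ * Φ c * κ (c 0)) := by
  intro B g hB hg hm p hp q hq r hr
  have h1 := h B g hB hg hm p hp q hq r hr
  simp only [← h1]
  simp [segCurve, mul_assoc]

theorem congr_on {Φ' : (unitInterval → X) → H} (h : IsPathCocycleOn U Φ)
    (he : ∀ c, Continuous c → (∀ t, c t ∈ U) → Φ' c = Φ c) : IsPathCocycleOn U Φ' := by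
  intro B g hB hg hm p hp q hq r hr
  have key : ∀ a ∈ B, ∀ b ∈ B, Φ' (segCurve g a b) = Φ (segCurve g a b) := fun a ha b hb =>
    he _ (continuous_segCurve hB hg ha hb) fun t => hm (lineMap_mem_of_convex hB ha hb t)
  rw [key _ hq _ hr, key _ hp _ hq, key _ hp _ hr, h B g hB hg hm p hp q hq r hr]

theorem map {H' : Type*} [Group H'] (h : IsPathCocycleOn U Φ) (f : H →* H') :
    IsPathCocycleOn U (fun c => f (Φ c)) := by
  intro B g hB hg hm p hp q hq r hr
  simp only [← map_mul, h B g hB hg hm p hp q hq r hr]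

/-- A constant curve is every side of a degenerate triangle, so its value is idempotent. -/
theorem const (h : IsPathCocycleOn U Φ) {x : X} (hx : x ∈ U) : Φ (fun _ => x) = 1 := by
  have := h Set.univ (fun _ => x) convex_univ continuousOn_const (fun _ _ => hx)
    0 trivial 0 trivial 0 trivial
  exact mul_eq_right.1 this

/-- The two ways around a square have the same value. -/
theorem square (h : IsPathCocycleOn U Φ) {g : ℝ → ℝ → X}
    (hg : ContinuousOn (Function.uncurry g) (Set.Icc 0 1 ×ˢ Set.Icc 0 1))
    (hm : ∀ s ∈ Set.Icc (0 : ℝ) 1, ∀ t ∈ Set.Icc (0 : ℝ) 1, g s t ∈ U) :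
    Φ (fun t => g 1 t) * Φ (fun s => g s 0) = Φ (fun s => g s 1) * Φ (fun t => g 0 t) := by
  have hB : Convex ℝ (Set.Icc (0 : ℝ) 1 ×ˢ Set.Icc (0 : ℝ) 1) :=
    (convex_Icc 0 1).prod (convex_Icc 0 1)
  have hm' : Set.MapsTo (Function.uncurry g) (Set.Icc 0 1 ×ˢ Set.Icc 0 1) U :=
    fun p hp => hm _ hp.1 _ hp.2
  have h1 := h _ _ hB hg hm' (0, 0) (by simp) (1, 0) (by simp) (1, 1) (by simp)
  have h2 := h _ _ hB hg hm' (0, 0) (by simp) (0, 1) (by simp) (1, 1) (by simp)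
  have h3 := h1.trans h2.symm
  unfold segCurve at h3
  simpa [AffineMap.lineMap_apply, Function.uncurry] using h3

/-- Multiplicativity under subdivision of a curve. -/
theorem subdivide (h : IsPathCocycleOn U Φ) {c : ℝ → X} {J : Set ℝ} (hJ : Convex ℝ J)
    (hc : ContinuousOn c J) (hm : ∀ t ∈ J, c t ∈ U) {a b d : ℝ} (ha : a ∈ J) (hb : b ∈ J)
    (hd : d ∈ J) :
    Φ (fun t => c (AffineMap.lineMap b d (t : ℝ))) * Φ (fun t => c (AffineMap.lineMap a b (t : ℝ)))
      = Φ (fun t => c (AffineMap.lineMap a d (t : ℝ))) := by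
  -- The triangle is degenerate: pulled back along the first coordinate, the curve lives on a convex
  -- strip and the three parameters become collinear points.
  have hB : Convex ℝ (J ×ˢ (Set.univ : Set ℝ)) := hJ.prod convex_univ
  have h1 := h _ (fun p => c p.1) hB
    (hc.comp continuousOn_fst fun p hp => hp.1) (fun p hp => hm _ hp.1) (a, 0) (by simpa) (b, 0)
    (by simpa) (d, 0) (by simpa)
  unfold segCurve at h1
  simpa [AffineMap.lineMap_apply] using h1

/-- In the square traced out by the homotopy, the two sides swept by the endpoints are constant and
contribute 1. -/
theorem homotopy (h : IsPathCocycleOn U Φ) {g : ℝ → ℝ → X}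
    (hg : ContinuousOn (Function.uncurry g) (Set.Icc 0 1 ×ˢ Set.Icc 0 1))
    (hm : ∀ s ∈ Set.Icc (0 : ℝ) 1, ∀ t ∈ Set.Icc (0 : ℝ) 1, g s t ∈ U) {x y : X}
    (h0 : ∀ s ∈ Set.Icc (0 : ℝ) 1, g s 0 = x) (h1 : ∀ s ∈ Set.Icc (0 : ℝ) 1, g s 1 = y) :
    Φ (fun t => g 1 t) = Φ (fun t => g 0 t) := by
  have hs := h.square hg hm
  have e0 : (fun s : unitInterval => g s 0) = fun _ => x := funext fun s => h0 s s.2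
  have e1 : (fun s : unitInterval => g s 1) = fun _ => y := funext fun s => h1 s s.2
  have hx : x ∈ U := h0 0 (by simp) ▸ hm 0 (by simp) 0 (by simp)
  have hy : y ∈ U := h1 0 (by simp) ▸ hm 0 (by simp) 1 (by simp)
  rwa [e0, e1, h.const hx, h.const hy, mul_one, one_mul] at hs

end IsPathCocycleOn

/-! ### From local to global path cocycles -/

/-- The first half of a curve. -/
def leftHalf (c : unitInterval → X) : unitInterval → X :=
  fun t => c ⟨t / 2, by have := t.2.1; positivity, by have := t.2.2; linarith⟩

/-- The second half of a curve. -/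
def rightHalf (c : unitInterval → X) : unitInterval → X :=
  fun t => c ⟨(1 + t) / 2, by have := t.2.1; positivity, by have := t.2.2; linarith⟩

theorem leftHalf_segCurve {X : Type*} (g : ℝ × ℝ → X) (p q : ℝ × ℝ) :
    leftHalf (segCurve g p q) = segCurve g p (midpoint ℝ p q) := by
  funext t
  simp only [leftHalf, segCurve]
  congr 1
  ext <;> simp [AffineMap.lineMap_apply, midpoint_eq_smul_add] <;> ring

theorem rightHalf_segCurve {X : Type*} (g : ℝ × ℝ → X) (p q : ℝ × ℝ) :
    rightHalf (segCurve g p q) = segCurve g (midpoint ℝ p q) q := by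
  funext t
  simp only [rightHalf, segCurve]
  congr 1
  ext <;> simp [AffineMap.lineMap_apply, midpoint_eq_smul_add] <;> ring

/-- The product of the values of `Φ` on the `2 ^ n` parts of a curve. -/
def dyadicProduct (Φ : (unitInterval → X) → H) : ℕ → (unitInterval → X) → H
  | 0, c => Φ c
  | n + 1, c => dyadicProduct Φ n (rightHalf c) * dyadicProduct Φ n (leftHalf c)

theorem dyadicProduct_segCurve {U : Set X} {Φ : (unitInterval → X) → H}
    (h : IsPathCocycleOn U Φ) {B : Set (ℝ × ℝ)} {g : ℝ × ℝ → X} (hB : Convex ℝ B)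
    (hg : ContinuousOn g B) (hm : Set.MapsTo g B U) (n : ℕ) :
    ∀ p ∈ B, ∀ q ∈ B, dyadicProduct Φ n (segCurve g p q) = Φ (segCurve g p q) := by
  induction n with
  | zero => intros; rfl
  | succ n ih =>
    intro p hp q hq
    have hc := hB.midpoint_mem hp hq
    rw [dyadicProduct, leftHalf_segCurve, rightHalf_segCurve, ih _ hc _ hq, ih _ hp _ hc]
    exact h B g hB hg hm _ hp _ hc _ hq

open Filter in
open scoped Classical in
/-- The eventual value of the dyadic products along a curve. -/
def dyadicLimit (Φ : (unitInterval → X) → H) (c : unitInterval → X) : H :=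
  -- The default 1 never matters for continuous curves, whose dyadic products stabilize.
  if h : ∃ a, ∀ᶠ n in atTop, dyadicProduct Φ n c = a then h.choose else 1

open Filter in
theorem dyadicLimit_eq {X : Type*} {Φ : (unitInterval → X) → H} {c : unitInterval → X} {a : H}
    (h : ∀ᶠ n in atTop, dyadicProduct Φ n c = a) : dyadicLimit Φ c = a := by
  have h' : ∃ a, ∀ᶠ n in atTop, dyadicProduct Φ n c = a := ⟨a, h⟩
  rw [dyadicLimit, dif_pos h']
  obtain ⟨n, h1, h2⟩ := (h'.choose_spec.and h).exists
  exact h1.symm.trans h2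

open Filter in
theorem eventually_dyadicProduct_of_halves {X : Type*} {Φ : (unitInterval → X) → H} {c : unitInterval → X}
    {a b : H} (hl : ∀ᶠ n in atTop, dyadicProduct Φ n (leftHalf c) = a)
    (hr : ∀ᶠ n in atTop, dyadicProduct Φ n (rightHalf c) = b) :
    ∀ᶠ n in atTop, dyadicProduct Φ n c = b * a := by
  have := hl.and hr
  rw [eventually_atTop] at this ⊢
  obtain ⟨N, hN⟩ := this
  refine ⟨N + 1, fun n hn => ?_⟩
  obtain ⟨k, rfl⟩ : ∃ k, n = k + 1 := ⟨n - 1, by omega⟩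
  rw [dyadicProduct, (hN k (by omega)).1, (hN k (by omega)).2]

theorem exists_lebesgue_number_plane {𝒰 : Set (Set X)} (ho : ∀ U ∈ 𝒰, IsOpen U)
    (hcov : ∀ x, ∃ U ∈ 𝒰, x ∈ U) {B : Set (ℝ × ℝ)} (hBc : IsCompact B)
    {g : ℝ × ℝ → X} (hg : ContinuousOn g B) :
    ∃ δ > 0, ∀ x ∈ B, ∃ U ∈ 𝒰, Set.MapsTo g (B ∩ Metric.ball x δ) U := by
  have h1 : ∀ x ∈ B, ∃ U ∈ 𝒰, ∃ V, IsOpen V ∧ x ∈ V ∧ Set.MapsTo g (B ∩ V) U := by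
    intro x hx
    obtain ⟨U, hU, hxU⟩ := hcov (g x)
    have := (hg x hx) ((ho U hU).mem_nhds hxU)
    rw [Filter.mem_map, mem_nhdsWithin] at this
    obtain ⟨V, hV, hxV, hs⟩ := this
    exact ⟨U, hU, V, hV, hxV, fun y hy => hs ⟨hy.2, hy.1⟩⟩
  choose U hU V hV hxV hm using h1
  obtain ⟨δ, hδ, h⟩ := lebesgue_number_lemma_of_metric (s := B) (c := fun x : B => V x x.2) hBc
    (fun x => hV _ _) (fun x hx => Set.mem_iUnion.2 ⟨⟨x, hx⟩, hxV x hx⟩)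
  refine ⟨δ, hδ, fun x hx => ?_⟩
  obtain ⟨i, hi⟩ := h x hx
  exact ⟨U i i.2, hU _ _, (hm i i.2).mono_left (Set.inter_subset_inter_right _ hi)⟩

theorem dist_midpoint_midpoint_same (p q r : ℝ × ℝ) :
    dist (midpoint ℝ p q) (midpoint ℝ p r) = dist q r / 2 := by
  have h : midpoint ℝ p q - midpoint ℝ p r = (1 / 2 : ℝ) • (q - r) := by
    simp only [midpoint_eq_smul_add, invOf_eq_inv]; module
  rw [dist_eq_norm, h, norm_smul, dist_eq_norm]
  norm_num
  ring

-- Segments shorter than a Lebesgue number stay in one member of the cover, where halving does not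
-- change the product. Longer segments follow by doubling the admissible length.
open Filter in
theorem exists_eventually_dyadicProduct {𝒰 : Set (Set X)} (ho : ∀ U ∈ 𝒰, IsOpen U)
    (hcov : ∀ x, ∃ U ∈ 𝒰, x ∈ U) {Φ : (unitInterval → X) → H}
    (hΦ : ∀ U ∈ 𝒰, IsPathCocycleOn U Φ) {B : Set (ℝ × ℝ)} (hB : Convex ℝ B) (hBc : IsCompact B)
    {g : ℝ × ℝ → X} (hg : ContinuousOn g B) {p q : ℝ × ℝ} (hp : p ∈ B) (hq : q ∈ B) :
    ∃ a, ∀ᶠ n in atTop, dyadicProduct Φ n (segCurve g p q) = a := by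
  obtain ⟨δ, hδ, hL⟩ := exists_lebesgue_number_plane ho hcov hBc hg
  have key : ∀ k : ℕ, ∀ p ∈ B, ∀ q ∈ B, dist p q < 2 ^ k * δ →
      ∃ a, ∀ᶠ n in atTop, dyadicProduct Φ n (segCurve g p q) = a := by
    intro k
    induction k with
    | zero =>
      intro p hp q hq hd
      obtain ⟨U, hU, hm⟩ := hL p hp
      have hd' : q ∈ Metric.ball p δ := by
        rw [Metric.mem_ball, dist_comm]; simpa using hd
      exact ⟨_, Eventually.of_forall fun n => dyadicProduct_segCurve (hΦ U hU)
        (hB.inter (convex_ball p δ)) (hg.mono Set.inter_subset_left) hm n p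
        ⟨hp, Metric.mem_ball_self hδ⟩ q ⟨hq, hd'⟩⟩
    | succ k ih =>
      intro p hp q hq hd
      have hc := hB.midpoint_mem hp hq
      rw [pow_succ] at hd
      obtain ⟨a, ha⟩ := ih p hp _ hc (by
        rw [dist_left_midpoint]; norm_num; linarith)
      obtain ⟨b, hb⟩ := ih _ hc q hq (by
        rw [dist_midpoint_right]; norm_num; linarith)
      rw [← leftHalf_segCurve] at ha
      rw [← rightHalf_segCurve] at hb
      exact ⟨_, eventually_dyadicProduct_of_halves ha hb⟩
  obtain ⟨k, hk⟩ := pow_unbounded_of_one_lt (dist p q / δ) (one_lt_two)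
  exact key k p hp q hq (by rwa [div_lt_iff₀ hδ] at hk)

theorem dyadicLimit_segCurve_of_mapsTo {U : Set X} {Φ : (unitInterval → X) → H}
    (h : IsPathCocycleOn U Φ) {B : Set (ℝ × ℝ)} {g : ℝ × ℝ → X} (hB : Convex ℝ B)
    (hg : ContinuousOn g B) (hm : Set.MapsTo g B U) {p q : ℝ × ℝ} (hp : p ∈ B) (hq : q ∈ B) :
    dyadicLimit Φ (segCurve g p q) = Φ (segCurve g p q) :=
  dyadicLimit_eq (Filter.Eventually.of_forall fun n =>
    dyadicProduct_segCurve h hB hg hm n p hp q hq)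

theorem exists_segCurve_eq {c : unitInterval → X} (hc : Continuous c) :
    ∃ g : ℝ × ℝ → X, Continuous g ∧ c = segCurve g (0, 0) (1, 0) ∧ ∀ p, ∃ t, g p = c t := by
  refine ⟨fun p => c (Set.projIcc 0 1 zero_le_one p.1), by fun_prop, ?_, fun p => ⟨_, rfl⟩⟩
  funext t
  simp [segCurve, AffineMap.lineMap_apply]

/-- Functions on curves that are path cocycles on the members of an open cover come from a path
cocycle on the whole space. -/
theorem exists_isPathCocycleOn_univ {𝒰 : Set (Set X)} (ho : ∀ U ∈ 𝒰, IsOpen U)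
    (hcov : ∀ x, ∃ U ∈ 𝒰, x ∈ U) {Φ : (unitInterval → X) → H}
    (hΦ : ∀ U ∈ 𝒰, IsPathCocycleOn U Φ) :
    ∃ Ψ : (unitInterval → X) → H, IsPathCocycleOn Set.univ Ψ ∧
      ∀ U ∈ 𝒰, ∀ c, Continuous c → (∀ t, c t ∈ U) → Ψ c = Φ c := by
  refine ⟨dyadicLimit Φ, ?_, ?_⟩
  · intro B₀ g hB₀ hg₀ _ p hp q hq r hr
    -- Only the triangle itself matters; passing to it supplies the compactness needed for a
    -- Lebesgue number.
    set B : Set (ℝ × ℝ) := convexHull ℝ {p, q, r} with hBdef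
    have hBB₀ : B ⊆ B₀ := convexHull_min (by
      intro x hx; rcases hx with rfl | rfl | rfl <;> assumption) hB₀
    have hB : Convex ℝ B := convex_convexHull ℝ _
    have hBc : IsCompact B := (Set.toFinite _).isCompact_convexHull ℝ
    have hg : ContinuousOn g B := hg₀.mono hBB₀
    replace hp : p ∈ B := subset_convexHull ℝ _ (by simp)
    replace hq : q ∈ B := subset_convexHull ℝ _ (by simp)
    replace hr : r ∈ B := subset_convexHull ℝ _ (by simp)
    clear_value B
    have hmid : ∀ p ∈ B, ∀ q ∈ B, dyadicLimit Φ (segCurve g (midpoint ℝ p q) q) *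
        dyadicLimit Φ (segCurve g p (midpoint ℝ p q)) = dyadicLimit Φ (segCurve g p q) := by
      intro p hp q hq
      have hc := hB.midpoint_mem hp hq
      obtain ⟨a, ha⟩ := exists_eventually_dyadicProduct ho hcov hΦ hB hBc hg hp hc
      obtain ⟨b, hb⟩ := exists_eventually_dyadicProduct ho hcov hΦ hB hBc hg hc hq
      rw [dyadicLimit_eq ha, dyadicLimit_eq hb]
      rw [← leftHalf_segCurve] at ha
      rw [← rightHalf_segCurve] at hb
      exact (dyadicLimit_eq (eventually_dyadicProduct_of_halves ha hb)).symm
    obtain ⟨δ, hδ, hL⟩ := exists_lebesgue_number_plane ho hcov hBc hg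
    -- Induction on the scale: the midpoints of the sides cut a triangle into four triangles of half
    -- the size, and the four relations combine to that of the big triangle.
    have key : ∀ k : ℕ, ∀ p ∈ B, ∀ q ∈ B, ∀ r ∈ B, dist p q < 2 ^ k * δ → dist p r < 2 ^ k * δ →
        dist q r < 2 ^ k * δ → dyadicLimit Φ (segCurve g q r) * dyadicLimit Φ (segCurve g p q) =
          dyadicLimit Φ (segCurve g p r) := by
      intro k
      induction k with
      | zero =>
        intro p hp q hq r hr h1 h2 h3
        obtain ⟨U, hU, hm⟩ := hL p hp
        have hB' := hB.inter (convex_ball p δ)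
        have hg' := hg.mono (Set.inter_subset_left (t := Metric.ball p δ))
        have hp' : p ∈ B ∩ Metric.ball p δ := ⟨hp, Metric.mem_ball_self hδ⟩
        have hq' : q ∈ B ∩ Metric.ball p δ := ⟨hq, by
          rw [Metric.mem_ball, dist_comm]; simpa using h1⟩
        have hr' : r ∈ B ∩ Metric.ball p δ := ⟨hr, by
          rw [Metric.mem_ball, dist_comm]; simpa using h2⟩
        rw [dyadicLimit_segCurve_of_mapsTo (hΦ U hU) hB' hg' hm hq' hr',
          dyadicLimit_segCurve_of_mapsTo (hΦ U hU) hB' hg' hm hp' hq',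
          dyadicLimit_segCurve_of_mapsTo (hΦ U hU) hB' hg' hm hp' hr']
        exact hΦ U hU _ g hB' hg' hm p hp' q hq' r hr'
      | succ k ih =>
        intro p hp q hq r hr h1 h2 h3
        rw [pow_succ] at h1 h2 h3
        have ha := hB.midpoint_mem hp hq
        have hb := hB.midpoint_mem hq hr
        have hc := hB.midpoint_mem hp hr
        have d1 : dist p (midpoint ℝ p q) = dist p q / 2 := by
          rw [dist_left_midpoint]; norm_num; ring
        have d2 : dist p (midpoint ℝ p r) = dist p r / 2 := by
          rw [dist_left_midpoint]; norm_num; ring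
        have d3 : dist (midpoint ℝ p q) q = dist p q / 2 := by
          rw [dist_midpoint_right]; norm_num; ring
        have d4 : dist q (midpoint ℝ q r) = dist q r / 2 := by
          rw [dist_left_midpoint]; norm_num; ring
        have d5 : dist (midpoint ℝ q r) r = dist q r / 2 := by
          rw [dist_midpoint_right]; norm_num; ring
        have d6 : dist (midpoint ℝ p r) r = dist p r / 2 := by
          rw [dist_midpoint_right]; norm_num; ring
        have d7 : dist (midpoint ℝ p q) (midpoint ℝ p r) = dist q r / 2 :=
          dist_midpoint_midpoint_same p q r
        have d8 : dist (midpoint ℝ p q) (midpoint ℝ q r) = dist p r / 2 := by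
          rw [midpoint_comm p q, dist_midpoint_midpoint_same q p r]
        have d9 : dist (midpoint ℝ p r) (midpoint ℝ q r) = dist p q / 2 := by
          rw [midpoint_comm p r, midpoint_comm q r, dist_midpoint_midpoint_same r p q]
        have t1 := ih p hp _ ha _ hc (by linarith) (by linarith) (by linarith)
        have t2 := ih _ ha q hq _ hb (by linarith) (by linarith) (by linarith)
        have t3 := ih _ hc _ hb r hr (by linarith) (by linarith) (by linarith)
        have t4 := ih _ ha _ hc _ hb (by linarith) (by linarith) (by linarith)
        rw [← hmid p hp q hq, ← hmid q hq r hr, ← hmid p hp r hr, ← t1, ← t3]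
        simp only [mul_assoc]
        congr 1
        rw [← mul_assoc, ← mul_assoc, t2, t4]
    obtain ⟨k, hk⟩ := pow_unbounded_of_one_lt
      ((dist p q + dist p r + dist q r) / δ) (one_lt_two)
    rw [div_lt_iff₀ hδ] at hk
    have n1 := dist_nonneg (x := p) (y := q)
    have n2 := dist_nonneg (x := p) (y := r)
    have n3 := dist_nonneg (x := q) (y := r)
    exact key k p hp q hq r hr (by linarith) (by linarith) (by linarith)
  · intro U hU c hc hcU
    obtain ⟨g, hg, rfl, hgc⟩ := exists_segCurve_eq hc
    refine dyadicLimit_segCurve_of_mapsTo (hΦ U hU) convex_univ hg.continuousOn (fun p _ => ?_)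
      trivial trivial
    obtain ⟨t, ht⟩ := hgc p
    rw [ht]; exact hcU t

end PathCocycle

/-! ### Path cocycles and fundamental groups -/

section FundamentalGroup

variable {X H : Type*} [TopologicalSpace X] [Group H]

namespace IsPathCocycleOn

variable {Φ : (unitInterval → X) → H}

theorem map_trans (h : IsPathCocycleOn Set.univ Φ) {x y z : X} (γ : Path x y) (δ : Path y z) :
    Φ (γ.trans δ) = Φ δ * Φ γ := by
  have h1 := h.subdivide (c := (γ.trans δ).extend) (J := Set.univ) (a := 0) (b := 1 / 2) (d := 1)
    convex_univ (γ.trans δ).continuous_extend.continuousOn (fun _ _ => trivial)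
    trivial trivial trivial
  have e1 : (fun t : unitInterval => (γ.trans δ).extend (AffineMap.lineMap (1 / 2 : ℝ) 1 (t : ℝ)))
      = δ := by
    funext t
    have h0 := t.2.1
    have h1 := t.2.2
    have e : AffineMap.lineMap (1 / 2 : ℝ) 1 (t : ℝ) = (1 + t : ℝ) / 2 := by
      simp [AffineMap.lineMap_apply]; ring
    rw [e, Path.extend_apply _ ⟨by positivity, by linarith⟩, Path.trans_apply]
    split_ifs with hh
    · have ht : t = 0 := Subtype.ext (by
        have hh' : (1 + (t : ℝ)) / 2 ≤ 1 / 2 := hh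
        show (t : ℝ) = 0
        linarith)
      subst ht
      simp
    · congr 1
      ext
      simp
      ring
  have e2 : (fun t : unitInterval => (γ.trans δ).extend (AffineMap.lineMap (0 : ℝ) (1 / 2) (t : ℝ)))
      = γ := by
    funext t
    have h0 := t.2.1
    have h1 := t.2.2
    have e : AffineMap.lineMap (0 : ℝ) (1 / 2) (t : ℝ) = (t : ℝ) / 2 := by
      simp [AffineMap.lineMap_apply]; ring
    rw [e, Path.extend_apply _ ⟨by positivity, by linarith⟩, Path.trans_apply]
    rw [dif_pos (by show (t : ℝ) / 2 ≤ 1 / 2; linarith)]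
    congr 1
    ext
    simp
    ring
  rw [e1, e2] at h1
  rw [h1]
  have e3 : (fun t : unitInterval => (γ.trans δ).extend (AffineMap.lineMap (0 : ℝ) 1 (t : ℝ)))
      = γ.trans δ := by
    funext t
    have e : AffineMap.lineMap (0 : ℝ) 1 (t : ℝ) = (t : ℝ) := by simp [AffineMap.lineMap_apply]
    rw [e, Path.extend_apply _ t.2]
  rw [e3]

theorem eq_of_homotopic (h : IsPathCocycleOn Set.univ Φ) {x y : X} {γ δ : Path x y}
    (hγδ : γ.Homotopic δ) : Φ γ = Φ δ := by
  obtain ⟨F⟩ := hγδ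
  have h1 := h.homotopy
    (g := fun s t => F (Set.projIcc 0 1 zero_le_one s, Set.projIcc 0 1 zero_le_one t))
    (x := x) (y := y)
    (by unfold Function.uncurry; fun_prop) (fun _ _ _ _ => trivial) (fun s _ => by simp)
    (fun s _ => by simp)
  simpa using h1.symm

/-- The homomorphism defined by a path cocycle. -/
def toHom (h : IsPathCocycleOn Set.univ Φ) (x : X) : FundamentalGroup X x →* H where
  toFun := Quotient.lift (fun γ : Path x x => Φ γ) fun _ _ hγ => h.eq_of_homotopic hγ
  map_one' := h.const (x := x) trivial
  map_mul' p q := by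
    induction p using Path.Homotopic.Quotient.ind with | _ γ
    induction q using Path.Homotopic.Quotient.ind with | _ δ
    -- The product in `FundamentalGroup` is concatenation in reverse order, hence the swap.
    exact h.map_trans δ γ

theorem toHom_mk (h : IsPathCocycleOn Set.univ Φ) {x : X} (γ : Path x x) :
    h.toHom x (FundamentalGroup.fromPath (Path.Homotopic.Quotient.mk γ)) = Φ γ := rfl

end IsPathCocycleOn

/-- The loop at `x₀` obtained from a path between two points joined to `x₀`. -/
def basedLoop {x₀ x y : X} (hx : Joined x₀ x) (hy : Joined x₀ y) (γ : Path x y) :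
    FundamentalGroup X x₀ :=
  FundamentalGroup.fromPath ((Path.Homotopic.Quotient.mk hx.somePath).trans
    ((Path.Homotopic.Quotient.mk γ).trans (Path.Homotopic.Quotient.mk hy.somePath).symm))

theorem basedLoop_trans {x₀ x y z : X} (hx : Joined x₀ x) (hy : Joined x₀ y) (hz : Joined x₀ z)
    (γ : Path x y) (δ : Path y z) :
    basedLoop hy hz δ * basedLoop hx hy γ = basedLoop hx hz (γ.trans δ) := by
  simp only [basedLoop, FundamentalGroup.mul_def, FundamentalGroup.fromPath,
    FundamentalGroup.fromArrow, Path.Homotopic.Quotient.mk_trans,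
    Path.Homotopic.Quotient.trans_assoc]
  rw [← Path.Homotopic.Quotient.trans_assoc _ (Path.Homotopic.Quotient.mk hy.somePath),
    Path.Homotopic.Quotient.symm_trans, Path.Homotopic.Quotient.refl_trans]

theorem basedLoop_congr {x₀ x y : X} (hx : Joined x₀ x) (hy : Joined x₀ y)
    {γ δ : Path x y} (h : γ.Homotopic δ) : basedLoop hx hy γ = basedLoop hx hy δ := by
  rw [basedLoop, basedLoop, Path.Homotopic.Quotient.eq.2 h]

theorem basedLoop_self {x₀ : X} (h : Joined x₀ x₀) (γ : Path x₀ x₀) :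
    basedLoop h h γ =
      (FundamentalGroup.fromPath (Path.Homotopic.Quotient.mk h.somePath))⁻¹ *
        FundamentalGroup.fromPath (Path.Homotopic.Quotient.mk γ) *
        FundamentalGroup.fromPath (Path.Homotopic.Quotient.mk h.somePath) := rfl

open scoped Classical in
/-- The path cocycle with values in the fundamental group. -/
def universalCocycle (x₀ : X) (c : unitInterval → X) : FundamentalGroup X x₀ :=
  -- The value 1 off the path component of `x₀` does no harm: a continuous triangle lies in a single
  -- path component.
  if h : ∃ x y, ∃ γ : Path x y, ⇑γ = c ∧ Joined x₀ x ∧ Joined x₀ y then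
    basedLoop h.choose_spec.choose_spec.choose_spec.2.1 h.choose_spec.choose_spec.choose_spec.2.2
      h.choose_spec.choose_spec.choose
  else 1

theorem universalCocycle_path {x₀ x y : X} (hx : Joined x₀ x) (hy : Joined x₀ y) (γ : Path x y) :
    universalCocycle x₀ γ = basedLoop hx hy γ := by
  have h : ∃ x' y', ∃ γ' : Path x' y', ⇑γ' = ⇑γ ∧ Joined x₀ x' ∧ Joined x₀ y' :=
    ⟨x, y, γ, rfl, hx, hy⟩
  rw [universalCocycle, dif_pos h]
  have key : ∀ (x' y' : X) (γ' : Path x' y') (hx' : Joined x₀ x') (hy' : Joined x₀ y'),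
      ⇑γ' = ⇑γ → basedLoop hx' hy' γ' = basedLoop hx hy γ := by
    intro x' y' γ' hx' hy' he
    obtain rfl : x' = x := by rw [← γ'.source, he, γ.source]
    obtain rfl : y' = y := by rw [← γ'.target, he, γ.target]
    obtain rfl : γ' = γ := Path.ext he
    rfl
  exact key _ _ _ _ _ h.choose_spec.choose_spec.choose_spec.1

theorem universalCocycle_of_not_joined {x₀ x y : X} (hx : ¬ Joined x₀ x) (γ : Path x y) :
    universalCocycle x₀ γ = 1 := by
  rw [universalCocycle, dif_neg]
  rintro ⟨x', y', γ', he, hx', -⟩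
  obtain rfl : x' = x := by rw [← γ'.source, he, γ.source]
  exact hx hx'

/-- A convex set is contractible, so the two routes from `p` to `r` are homotopic in `B`, and `g`
carries the homotopy to `X`. -/
theorem isPathCocycleOn_universalCocycle (x₀ : X) :
    IsPathCocycleOn Set.univ (universalCocycle x₀) := by
  intro B g hB hg _ p hp q hq r hr
  let s : ∀ a b : B, Path a b := fun a b =>
    { toFun := fun t => ⟨AffineMap.lineMap (a : ℝ × ℝ) b (t : ℝ), lineMap_mem_of_convex hB a.2 b.2 t⟩
      continuous_toFun := by fun_prop
      source' := by ext <;> simp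
      target' := by ext <;> simp }
  let f : C(B, X) := ⟨B.domRestrict g, hg.domRestrict⟩
  have he : ∀ a b : B, segCurve g a b = ⇑((s a b).map f.continuous) := fun a b => rfl
  have : ContractibleSpace B := hB.contractibleSpace ⟨p, hp⟩
  have hom := (SimplyConnectedSpace.paths_homotopic
    ((s ⟨p, hp⟩ ⟨q, hq⟩).trans (s ⟨q, hq⟩ ⟨r, hr⟩)) (s ⟨p, hp⟩ ⟨r, hr⟩)).map f
  rw [Path.map_trans] at hom
  rw [he ⟨q, hq⟩ ⟨r, hr⟩, he ⟨p, hp⟩ ⟨q, hq⟩, he ⟨p, hp⟩ ⟨r, hr⟩]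
  have j1 : Joined (f ⟨p, hp⟩) (f ⟨q, hq⟩) := ⟨(s ⟨p, hp⟩ ⟨q, hq⟩).map f.continuous⟩
  have j2 : Joined (f ⟨q, hq⟩) (f ⟨r, hr⟩) := ⟨(s ⟨q, hq⟩ ⟨r, hr⟩).map f.continuous⟩
  by_cases hx : Joined x₀ (f ⟨p, hp⟩)
  · have hy := hx.trans j1
    have hz := hy.trans j2
    rw [universalCocycle_path hx hy, universalCocycle_path hy hz, universalCocycle_path hx hz,
      basedLoop_trans, basedLoop_congr hx hz hom]
  · rw [universalCocycle_of_not_joined hx, universalCocycle_of_not_joined hx,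
      universalCocycle_of_not_joined (fun h => hx (h.trans j1.symm)), one_mul]

/-- The values of the universal cocycle on loops are conjugate to their classes. -/
theorem exists_universalCocycle_loop (x₀ : X) : ∃ a : FundamentalGroup X x₀, ∀ γ : Path x₀ x₀,
    universalCocycle x₀ γ =
      a⁻¹ * FundamentalGroup.fromPath (Path.Homotopic.Quotient.mk γ) * a :=
  ⟨_, fun γ => (universalCocycle_path (Joined.refl x₀) (Joined.refl x₀) γ).trans
    (basedLoop_self _ γ)⟩

end FundamentalGroup

/-! ### Two-cocycles on simplicial sets without homology in degrees one and two -/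

section Simplicial

open Simplicial Limits

/-- The coefficient module of integral homology. -/
abbrev integerModule : ModuleCat.{u} ℤ := ModuleCat.of ℤ (ULift.{u} ℤ)

/-- The map of modules that sends `1` to `m`. -/
def integerModuleHom {M : ModuleCat.{u} ℤ} (m : M) : integerModule.{u} ⟶ M :=
  ModuleCat.ofHom ((LinearMap.toSpanSingleton ℤ M m).comp ULift.moduleEquiv.toLinearMap)

theorem integerModuleHom_one {M : ModuleCat.{u} ℤ} (m : M) :
    (integerModuleHom m).hom (ULift.up 1) = m := by
  simp only [integerModuleHom, ModuleCat.hom_ofHom, LinearMap.comp_apply,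
    LinearMap.toSpanSingleton_apply]
  rw [show ULift.moduleEquiv.toLinearMap (ULift.up.{u} (1 : ℤ)) = (1 : ℤ) from rfl]
  exact @one_smul ℤ M _ M.isModule.toMulAction m

theorem integerModuleHom_ext {M : ModuleCat.{u} ℤ} {f g : integerModule.{u} ⟶ M}
    (h : f.hom (ULift.up 1) = g.hom (ULift.up 1)) : f = g := by
  ext ⟨x⟩
  have e : (ULift.up x : ULift.{u} ℤ) = x • ULift.up 1 := by ext; simp
  change f.hom _ = g.hom _
  rw [e, map_zsmul, map_zsmul, h]

variable (S : SSet.{u})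

/-- The homomorphism on chains with prescribed values on simplices. -/
def chainDesc {n : ℕ} {M : ModuleCat.{u} ℤ} (φ : S _⦋n⦌ → M) :
    (S.chainComplex integerModule).X n ⟶ M :=
  Cofan.IsColimit.desc (S.isColimitChainComplexXCofan integerModule n)
    (fun σ => integerModuleHom (φ σ))

theorem ι_chainDesc {n : ℕ} {M : ModuleCat.{u} ℤ} (φ : S _⦋n⦌ → M) (σ : S _⦋n⦌) :
    S.ιChainComplex σ ≫ chainDesc S φ = integerModuleHom (φ σ) :=
  Cofan.IsColimit.fac (S.isColimitChainComplexXCofan integerModule n) _ σ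

/-- The chain given by a simplex. -/
def simplexChain {n : ℕ} (σ : S _⦋n⦌) : (S.chainComplex integerModule.{u}).X n :=
  (S.ιChainComplex (R := integerModule.{u}) σ).hom (ULift.up 1)

theorem chainDesc_simplexChain {n : ℕ} {M : ModuleCat.{u} ℤ} (φ : S _⦋n⦌ → M) (σ : S _⦋n⦌) :
    (chainDesc S φ).hom (simplexChain S σ) = φ σ :=
  (congrArg (fun k => k.hom (ULift.up 1)) (ι_chainDesc S φ σ)).trans (integerModuleHom_one _)

theorem d_simplexChain {n : ℕ} (σ : S _⦋n + 1⦌) :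
    ((S.chainComplex integerModule.{u}).d (n + 1) n).hom (simplexChain S σ) =
      ∑ i : Fin (n + 2), (-1 : ℤ) ^ (i : ℕ) • simplexChain S (S.δ i σ) := by
  refine (congrArg (fun k => k.hom (ULift.up 1))
    (SSet.ιChainComplex_d (R := integerModule.{u}) S σ)).trans ?_
  simp only [ModuleCat.hom_sum, LinearMap.sum_apply]
  rfl

theorem d_simplexChain_one (σ : S _⦋1⦌) :
    ((S.chainComplex integerModule.{u}).d 1 0).hom (simplexChain S σ) =
      simplexChain S (S.δ 0 σ) - simplexChain S (S.δ 1 σ) := by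
  rw [d_simplexChain S (n := 0), Fin.sum_univ_succ, Fin.sum_univ_succ]
  simp [sub_eq_add_neg]

theorem d_simplexChain_two (σ : S _⦋2⦌) :
    ((S.chainComplex integerModule.{u}).d 2 1).hom (simplexChain S σ) =
      simplexChain S (S.δ 0 σ) - simplexChain S (S.δ 1 σ) + simplexChain S (S.δ 2 σ) := by
  rw [d_simplexChain S (n := 1), Fin.sum_univ_succ, Fin.sum_univ_succ, Fin.sum_univ_succ]
  simp [sub_eq_add_neg, add_assoc]

theorem d_simplexChain_three (σ : S _⦋3⦌) :
    ((S.chainComplex integerModule.{u}).d 3 2).hom (simplexChain S σ) =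
      simplexChain S (S.δ 0 σ) - simplexChain S (S.δ 1 σ) + simplexChain S (S.δ 2 σ) -
        simplexChain S (S.δ 3 σ) := by
  rw [d_simplexChain S (n := 2), Fin.sum_univ_succ, Fin.sum_univ_succ, Fin.sum_univ_succ,
    Fin.sum_univ_succ]
  simp [sub_eq_add_neg, add_assoc]

theorem chainHom_ext {n : ℕ} {M : ModuleCat.{u} ℤ}
    {f g : (S.chainComplex integerModule.{u}).X n ⟶ M}
    (h : ∀ σ, f.hom (simplexChain S σ) = g.hom (simplexChain S σ)) : f = g :=
  SSet.chainComplex_hom_ext fun σ => integerModuleHom_ext (h σ)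

theorem exists_chain_of_isZero_homology {n : ℕ}
    (h : IsZero (S.homology integerModule.{u} (n + 1)))
    (x : (S.chainComplex integerModule.{u}).X (n + 1))
    (hx : ((S.chainComplex integerModule.{u}).d (n + 1) n).hom x = 0) :
    ∃ y, ((S.chainComplex integerModule.{u}).d (n + 2) (n + 1)).hom y = x := by
  have h1 := ((S.chainComplex integerModule.{u}).exactAt_iff_isZero_homology (n + 1)).2 h
  rw [HomologicalComplex.exactAt_iff' _ (n + 2) (n + 1) n (by simp) (by simp),
    ShortComplex.moduleCat_exact_iff] at h1
  exact h1 x hx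

/-- This is the vanishing of H² with arbitrary coefficients. Since chains are free, fillings of
1-cycles can be chosen linearly, and the required cochain is `e` evaluated on the fillings. The
edges `t x` from `x₀` to `x` close up arbitrary edges to cycles. -/
theorem exists_cochain_of_isZero_homology {A : Type} [AddCommGroup A]
    (h1 : IsZero (S.homology integerModule.{u} 1)) (h2 : IsZero (S.homology integerModule.{u} 2))
    (x₀ : S _⦋0⦌) (t : S _⦋0⦌ → S _⦋1⦌) (ht0 : ∀ x, S.δ 0 (t x) = x) (ht1 : ∀ x, S.δ 1 (t x) = x₀)
    (e : S _⦋2⦌ → A)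
    (he : ∀ τ : S _⦋3⦌, e (S.δ 0 τ) - e (S.δ 1 τ) + e (S.δ 2 τ) - e (S.δ 3 τ) = 0) :
    ∃ f : S _⦋1⦌ → A, ∀ σ : S _⦋2⦌, e σ = f (S.δ 0 σ) - f (S.δ 1 σ) + f (S.δ 2 σ) := by
  let C := S.chainComplex integerModule.{u}
  let M : ModuleCat.{u} ℤ := ModuleCat.of ℤ (ULift.{u} A)
  let e' : C.X 2 ⟶ M := chainDesc S fun σ => (ULift.up (e σ) : ULift.{u} A)
  have he' : ∀ σ, e'.hom (simplexChain S σ) = (ULift.up (e σ) : ULift.{u} A) :=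
    chainDesc_simplexChain S _
  have hde : ∀ y, e'.hom ((C.d 3 2).hom y) = 0 := by
    have : C.d 3 2 ≫ e' = 0 := by
      refine chainHom_ext S fun τ => ?_
      change e'.hom ((C.d 3 2).hom (simplexChain S τ)) = 0
      rw [d_simplexChain_three, map_sub, map_add, map_sub, he', he', he', he']
      exact congrArg ULift.up.{u} (he τ)
    exact fun y => congrArg (fun k => k.hom y) this
  let T : C.X 0 ⟶ C.X 1 := chainDesc S fun x => simplexChain S (t x)
  have hT : ∀ x, T.hom (simplexChain S x) = simplexChain S (t x) := chainDesc_simplexChain S _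
  -- `R` closes an edge to a cycle by joining its ends to `x₀`; it is the identity on boundaries.
  let R : C.X 1 ⟶ C.X 1 := 𝟙 _ - C.d 1 0 ≫ T
  have hR : ∀ x, R.hom x = x - T.hom ((C.d 1 0).hom x) := fun x => rfl
  have hdd : ∀ x, (C.d 1 0).hom ((C.d 2 1).hom x) = 0 := fun x =>
    congrArg (fun k => k.hom x) (C.d_comp_d 2 1 0)
  have hRd : ∀ γ, (C.d 1 0).hom (R.hom (simplexChain S γ)) = 0 := by
    intro γ
    rw [hR, d_simplexChain_one, map_sub, map_sub, hT, hT, map_sub, d_simplexChain_one,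
      d_simplexChain_one, d_simplexChain_one, ht0, ht0, ht1, ht1]
    abel
  choose b hb using fun γ => exists_chain_of_isZero_homology S h1 _ (hRd γ)
  let b' : C.X 1 ⟶ C.X 2 := chainDesc S b
  have hbd : ∀ x, (C.d 2 1).hom (b'.hom x) = R.hom x := by
    have : b' ≫ C.d 2 1 = R := chainHom_ext S fun γ => by
      refine Eq.trans ?_ (hb γ)
      exact congrArg (C.d 2 1).hom (chainDesc_simplexChain S b γ)
    exact fun x => congrArg (fun k => k.hom x) this
  -- The filling of the boundary of `x` differs from `x` by a 2-cycle, which bounds because H₂ = 0,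
  -- and `e'` kills boundaries.
  have hfin : ∀ x, e'.hom (b'.hom ((C.d 2 1).hom x)) = e'.hom x := by
    intro x
    have hx : (C.d 2 1).hom (b'.hom ((C.d 2 1).hom x) - x) = 0 := by
      rw [map_sub, hbd, hR, hdd, map_zero, sub_zero, sub_self]
    obtain ⟨y, hy⟩ := exists_chain_of_isZero_homology S h2 _ hx
    have e2 := hde y
    rw [show (C.d 3 2).hom y = _ from hy, map_sub, sub_eq_zero] at e2
    exact e2
  refine ⟨fun γ => ULift.down (e'.hom (b'.hom (simplexChain S γ)) : ULift.{u} A), fun σ => ?_⟩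
  have h3 := hfin (simplexChain S σ)
  rw [he', d_simplexChain_two, map_add, map_sub, map_add, map_sub] at h3
  exact congrArg ULift.down h3.symm

end Simplicial

/-! ### Lifting path cocycles through central extensions -/

section Lifting

open Simplicial Limits

variable {Y : Type u} [TopologicalSpace Y]

/-- The singular simplices of `Y`. -/
abbrev singularSet (Y : Type u) [TopologicalSpace Y] : SSet.{u} := TopCat.toSSet.obj (TopCat.of Y)

/-- The map on the standard simplex underlying a singular simplex. -/
def simplexMap {n : ℕ} (σ : (singularSet Y) _⦋n⦌) : C(stdSimplex ℝ (Fin (n + 1)), Y) :=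
  (TopCat.of Y).toSSetObjEquiv (Opposite.op ⦋n⦌) σ

/-- The singular simplex with a given underlying map. -/
def simplexOfMap {n : ℕ} (f : C(stdSimplex ℝ (Fin (n + 1)), Y)) : (singularSet Y) _⦋n⦌ :=
  ((TopCat.of Y).toSSetObjEquiv (Opposite.op ⦋n⦌)).symm f

theorem simplexMap_simplexOfMap {n : ℕ} (f : C(stdSimplex ℝ (Fin (n + 1)), Y)) :
    simplexMap (simplexOfMap f) = f :=
  Equiv.apply_symm_apply _ _

theorem simplexMap_injective {n : ℕ} :
    Function.Injective (simplexMap : (singularSet Y) _⦋n⦌ → C(stdSimplex ℝ (Fin (n + 1)), Y)) :=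
  Equiv.injective _

theorem simplexMap_δ {n : ℕ} (i : Fin (n + 2)) (σ : (singularSet Y) _⦋n + 1⦌)
    (z : stdSimplex ℝ (Fin (n + 1))) :
    simplexMap ((singularSet Y).δ i σ) z = simplexMap σ (stdSimplex.map i.succAbove z) :=
  TopCat.toSSetObjEquiv_δ_apply (X := TopCat.of Y) σ i z

/-- The point with parameter `t` on the edge from `a 0` to `a 1` of the standard simplex. -/
def edgePoint {n : ℕ} (a : Fin 2 → Fin (n + 1)) (t : unitInterval) : stdSimplex ℝ (Fin (n + 1)) :=
  stdSimplex.map a (stdSimplexHomeomorphUnitInterval.symm t)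

theorem edgePoint_apply {n : ℕ} (a : Fin 2 → Fin (n + 1)) (t : unitInterval) (k : Fin (n + 1)) :
    edgePoint a t k = (if a 0 = k then 1 - (t : ℝ) else 0) + if a 1 = k then (t : ℝ) else 0 := by
  have h0 : (stdSimplexHomeomorphUnitInterval.symm t) 0 = 1 - (t : ℝ) := rfl
  have h1 : (stdSimplexHomeomorphUnitInterval.symm t) 1 = (t : ℝ) := rfl
  rw [edgePoint, stdSimplex.map_coe, FunOnFinite.linearMap_apply_apply, Finset.sum_filter,
    Fin.sum_univ_two, h0, h1]

theorem continuous_edgePoint {n : ℕ} (a : Fin 2 → Fin (n + 1)) : Continuous (edgePoint a) :=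
  (stdSimplex.continuous_map a).comp stdSimplexHomeomorphUnitInterval.symm.continuous

/-- The curve along an edge of a singular simplex. -/
def edgeCurve {n : ℕ} (σ : (singularSet Y) _⦋n⦌) (a : Fin 2 → Fin (n + 1)) : unitInterval → Y :=
  fun t => simplexMap σ (edgePoint a t)

theorem edgeCurve_δ {n : ℕ} (i : Fin (n + 2)) (σ : (singularSet Y) _⦋n + 1⦌)
    (a : Fin 2 → Fin (n + 1)) :
    edgeCurve ((singularSet Y).δ i σ) a = edgeCurve σ (i.succAbove ∘ a) := by
  funext t
  rw [edgeCurve, simplexMap_δ, edgePoint, stdSimplex.map_comp_apply]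
  rfl

theorem continuous_edgeCurve {n : ℕ} (σ : (singularSet Y) _⦋n⦌) (a : Fin 2 → Fin (n + 1)) :
    Continuous (edgeCurve σ a) :=
  (simplexMap σ).continuous.comp (continuous_edgePoint a)

/-- The singular edge given by a curve. -/
def edgeOfCurve (c : C(unitInterval, Y)) : (singularSet Y) _⦋1⦌ :=
  simplexOfMap (c.comp ⟨_, stdSimplexHomeomorphUnitInterval.continuous⟩)

theorem edgeOfCurve_edgeCurve (γ : (singularSet Y) _⦋1⦌) :
    edgeOfCurve ⟨edgeCurve γ ![0, 1], continuous_edgeCurve γ _⟩ = γ := by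
  apply simplexMap_injective
  rw [edgeOfCurve, simplexMap_simplexOfMap]
  ext z
  simp only [ContinuousMap.comp_apply, ContinuousMap.coe_mk, edgeCurve]
  have : (![0, 1] : Fin 2 → Fin 2) = id := by ext i; fin_cases i <;> rfl
  rw [edgePoint, this, stdSimplex.map_id_apply, Homeomorph.symm_apply_apply]

/-- The singular triangle given by a map on a convex subset of the plane. -/
def triangleOfMap {B : Set (ℝ × ℝ)} (hB : Convex ℝ B) {g : ℝ × ℝ → Y} (hg : ContinuousOn g B)
    {p q r : ℝ × ℝ} (hp : p ∈ B) (hq : q ∈ B) (hr : r ∈ B) : (singularSet Y) _⦋2⦌ :=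
  simplexOfMap ⟨fun x => g (x 0 • p + x 1 • q + x 2 • r), by
    refine hg.comp_continuous ?_ ?_
    · have h : ∀ i, Continuous fun x : stdSimplex ℝ (Fin 3) => x i := fun i =>
        (continuous_apply i).comp continuous_subtype_val
      exact (((h 0).smul continuous_const).add ((h 1).smul continuous_const)).add
        ((h 2).smul continuous_const)
    · intro x
      have hs : x 0 + x 1 + x 2 = 1 := by
        rw [← stdSimplex.sum_eq_one x, Fin.sum_univ_three]
      have := hB.sum_mem (t := Finset.univ) (w := x) (z := ![p, q, r])
        (fun i _ => stdSimplex.zero_le x i) (stdSimplex.sum_eq_one x)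
        (fun i _ => by fin_cases i <;> assumption)
      simpa [Fin.sum_univ_three] using this⟩

theorem edgeCurve_triangleOfMap {B : Set (ℝ × ℝ)} (hB : Convex ℝ B) {g : ℝ × ℝ → Y}
    (hg : ContinuousOn g B) {p q r : ℝ × ℝ} (hp : p ∈ B) (hq : q ∈ B) (hr : r ∈ B) :
    edgeCurve (triangleOfMap hB hg hp hq hr) ![0, 1] = segCurve g p q ∧
    edgeCurve (triangleOfMap hB hg hp hq hr) ![1, 2] = segCurve g q r ∧
    edgeCurve (triangleOfMap hB hg hp hq hr) ![0, 2] = segCurve g p r := by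
  refine ⟨?_, ?_, ?_⟩ <;> funext t <;>
    simp only [edgeCurve, triangleOfMap, simplexMap_simplexOfMap, ContinuousMap.coe_mk, segCurve,
      edgePoint_apply, AffineMap.lineMap_apply_module] <;> simp

variable {H : Type} [Group H]

theorem mul_mul_inv_of_mem_center {x y w z₀ z₁ z₂ : H} (h₀ : z₀ ∈ Subgroup.center H)
    (h₂ : z₂ ∈ Subgroup.center H) (h : x * y = z₀ / z₁ * z₂ * w) :
    x * z₀⁻¹ * (y * z₂⁻¹) = z₁⁻¹ * w := by
  have c₀ := Subgroup.mem_center_iff.1 (inv_mem h₀) x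
  have c₂ := Subgroup.mem_center_iff.1 h₂ w
  calc x * z₀⁻¹ * (y * z₂⁻¹) = z₀⁻¹ * (x * y) * z₂⁻¹ := by rw [c₀]; group
    _ = z₁⁻¹ * (z₂ * w) * z₂⁻¹ := by rw [h, div_eq_mul_inv]; group
    _ = z₁⁻¹ * w := by rw [← c₂]; group

/-- The last two barycentric coordinates identify the standard 2-simplex with a convex triangle in
the plane, where the cocycle rule applies. -/
theorem IsPathCocycleOn.edgeCurve_two {Φ : (unitInterval → Y) → H}
    (h : IsPathCocycleOn Set.univ Φ) (σ : (singularSet Y) _⦋2⦌) :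
    Φ (edgeCurve σ ![1, 2]) * Φ (edgeCurve σ ![0, 1]) = Φ (edgeCurve σ ![0, 2]) := by
  classical
  let B : Set (ℝ × ℝ) := {p | 0 ≤ p.1 ∧ 0 ≤ p.2 ∧ p.1 + p.2 ≤ 1}
  have hmem : ∀ p : ℝ × ℝ, p ∈ B → ![1 - p.1 - p.2, p.1, p.2] ∈ stdSimplex ℝ (Fin 3) := by
    rintro p ⟨h1, h2, h3⟩
    refine ⟨fun i => ?_, by simp [Fin.sum_univ_three]; ring⟩
    fin_cases i
    · show (0 : ℝ) ≤ 1 - p.1 - p.2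
      linarith
    · exact h1
    · exact h2
  let g : ℝ × ℝ → Y := fun p => if hp : p ∈ B then simplexMap σ ⟨_, hmem p hp⟩ else
    simplexMap σ (stdSimplex.vertex 0)
  have hB : Convex ℝ B := by
    rintro ⟨x1, x2⟩ ⟨h1, h2, h3⟩ ⟨y1, y2⟩ ⟨k1, k2, k3⟩ a b ha hb hab
    simp only at h1 h2 h3 k1 k2 k3
    refine ⟨?_, ?_, ?_⟩
    · simp only [Prod.fst_add, Prod.smul_mk, smul_eq_mul]; positivity
    · simp only [Prod.snd_add, Prod.smul_mk, smul_eq_mul]; positivity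
    · simp only [Prod.fst_add, Prod.snd_add, Prod.smul_mk, smul_eq_mul]
      nlinarith
  have hg : ContinuousOn g B := by
    rw [continuousOn_iff_continuous_domRestrict]
    have : B.domRestrict g = fun p : B => simplexMap σ ⟨_, hmem p p.2⟩ := by
      funext p
      exact dif_pos p.2
    rw [this]
    refine (simplexMap σ).continuous.comp (Continuous.subtype_mk ?_ _)
    refine continuous_pi fun i => ?_
    fin_cases i <;> simp <;> fun_prop
  have h0 : ((0, 0) : ℝ × ℝ) ∈ B := by simp [B]
  have h1 : ((1, 0) : ℝ × ℝ) ∈ B := by simp [B]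
  have h2 : ((0, 1) : ℝ × ℝ) ∈ B := by simp [B]
  have key : ∀ (a : Fin 2 → Fin 3) (p q : ℝ × ℝ), p ∈ B → q ∈ B →
      (∀ t : unitInterval, (edgePoint a t : Fin 3 → ℝ) =
        ![1 - (AffineMap.lineMap p q (t : ℝ)).1 - (AffineMap.lineMap p q (t : ℝ)).2,
          (AffineMap.lineMap p q (t : ℝ)).1, (AffineMap.lineMap p q (t : ℝ)).2]) →
      edgeCurve σ a = segCurve g p q := by
    intro a p q hp hq hpt
    funext t
    rw [edgeCurve, segCurve]
    refine Eq.trans ?_ (dif_pos (lineMap_mem_of_convex hB hp hq t)).symm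
    congr 1
    exact Subtype.ext (hpt t)
  rw [key ![1, 2] (1, 0) (0, 1) h1 h2, key ![0, 1] (0, 0) (1, 0) h0 h1,
    key ![0, 2] (0, 0) (0, 1) h0 h2]
  · exact h B g hB hg (fun _ _ => trivial) _ h0 _ h1 _ h2
  all_goals
    intro t
    funext k
    rw [edgePoint_apply]
    fin_cases k <;> simp [AffineMap.lineMap_apply, sub_eq_neg_add]

/-- On a path connected space without homology in degrees one and two, path cocycles lift through
the quotient by the center. -/
theorem IsPathCocycleOn.exists_lift_center [PathConnectedSpace Y]
    (h1 : IsZero (integralHomology Y 1)) (h2 : IsZero (integralHomology Y 2))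
    {Ψ : (unitInterval → Y) → H ⧸ Subgroup.center H} (hΨ : IsPathCocycleOn Set.univ Ψ) :
    ∃ Ψ' : (unitInterval → Y) → H, IsPathCocycleOn Set.univ Ψ' ∧
      ∀ c, (QuotientGroup.mk (Ψ' c) : H ⧸ Subgroup.center H) = Ψ c := by
  classical
  let _ : CommGroup (Subgroup.center H) :=
    { (inferInstance : Group (Subgroup.center H)) with
      mul_comm := fun x y => Subtype.ext (Subgroup.mem_center_iff.1 y.2 x) }
  -- A set-theoretic lift; its failure to be a cocycle is the central 2-cochain `e`.
  let a : (unitInterval → Y) → H := fun c => (Ψ c).out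
  have ha : ∀ c, (QuotientGroup.mk (a c) : H ⧸ Subgroup.center H) = Ψ c := fun c =>
    QuotientGroup.out_eq' _
  have hmem : ∀ σ : (singularSet Y) _⦋2⦌, a (edgeCurve σ ![1, 2]) * a (edgeCurve σ ![0, 1]) *
      (a (edgeCurve σ ![0, 2]))⁻¹ ∈ Subgroup.center H := by
    intro σ
    rw [← QuotientGroup.eq_one_iff, QuotientGroup.mk_mul, QuotientGroup.mk_mul,
      QuotientGroup.mk_inv, ha, ha, ha, hΨ.edgeCurve_two, mul_inv_cancel]
  let e : (singularSet Y) _⦋2⦌ → Additive (Subgroup.center H) := fun σ =>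
    Additive.ofMul ⟨_, hmem σ⟩
  have he : ∀ σ, a (edgeCurve σ ![1, 2]) * a (edgeCurve σ ![0, 1]) =
      ((e σ).toMul : H) * a (edgeCurve σ ![0, 2]) := fun σ => by simp [e]
  have hcomm : ∀ (z : Additive (Subgroup.center H)) (x : H), x * (z.toMul : H) = z.toMul * x :=
    fun z x => Subgroup.mem_center_iff.1 z.toMul.2 x
  -- Bracket the product of the values on the edges 01, 12, 23 of a tetrahedron in both ways;
  -- centrality lets the defects be collected on the left.
  have hcocycle : ∀ τ : (singularSet Y) _⦋3⦌, e ((singularSet Y).δ 0 τ) - e ((singularSet Y).δ 1 τ) +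
      e ((singularSet Y).δ 2 τ) - e ((singularSet Y).δ 3 τ) = 0 := by
    intro τ
    have f0 := he ((singularSet Y).δ 0 τ)
    have f1 := he ((singularSet Y).δ 1 τ)
    have f2 := he ((singularSet Y).δ 2 τ)
    have f3 := he ((singularSet Y).δ 3 τ)
    have s : ∀ (i : Fin 4) (x y : Fin 3), i.succAbove ∘ ![x, y] = ![i.succAbove x, i.succAbove y] :=
      fun i x y => by ext k; fin_cases k <;> rfl
    simp only [edgeCurve_δ, s] at f0 f1 f2 f3
    change a (edgeCurve τ ![2, 3]) * a (edgeCurve τ ![1, 2]) =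
      ((e ((singularSet Y).δ 0 τ)).toMul : H) * a (edgeCurve τ ![1, 3]) at f0
    change a (edgeCurve τ ![2, 3]) * a (edgeCurve τ ![0, 2]) =
      ((e ((singularSet Y).δ 1 τ)).toMul : H) * a (edgeCurve τ ![0, 3]) at f1
    change a (edgeCurve τ ![1, 3]) * a (edgeCurve τ ![0, 1]) =
      ((e ((singularSet Y).δ 2 τ)).toMul : H) * a (edgeCurve τ ![0, 3]) at f2
    change a (edgeCurve τ ![1, 2]) * a (edgeCurve τ ![0, 1]) =
      ((e ((singularSet Y).δ 3 τ)).toMul : H) * a (edgeCurve τ ![0, 2]) at f3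
    generalize e ((singularSet Y).δ 0 τ) = e0 at *
    generalize e ((singularSet Y).δ 1 τ) = e1 at *
    generalize e ((singularSet Y).δ 2 τ) = e2 at *
    generalize e ((singularSet Y).δ 3 τ) = e3 at *
    have l : a (edgeCurve τ ![2, 3]) * a (edgeCurve τ ![1, 2]) * a (edgeCurve τ ![0, 1]) =
        (e0.toMul : H) * e2.toMul * a (edgeCurve τ ![0, 3]) := by
      rw [f0, mul_assoc, f2, mul_assoc]
    have r : a (edgeCurve τ ![2, 3]) * a (edgeCurve τ ![1, 2]) * a (edgeCurve τ ![0, 1]) =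
        (e3.toMul : H) * e1.toMul * a (edgeCurve τ ![0, 3]) := by
      rw [mul_assoc, f3, ← mul_assoc, hcomm, mul_assoc, f1, mul_assoc]
    have h' : e0 + e2 = e3 + e1 := by
      apply Additive.toMul.injective
      exact Subtype.ext (mul_right_cancel (l.symm.trans r))
    rw [sub_add_eq_add_sub, h', sub_sub, add_comm e1 e3, sub_self]
  obtain ⟨y₀⟩ : Nonempty Y := inferInstance
  let x₀ : (singularSet Y) _⦋0⦌ := simplexOfMap (ContinuousMap.const _ y₀)
  let t : (singularSet Y) _⦋0⦌ → (singularSet Y) _⦋1⦌ := fun x =>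
    edgeOfCurve (PathConnectedSpace.somePath y₀ (simplexMap x default)).toContinuousMap
  have hvertex : ∀ (i : Fin 2) (x), stdSimplexHomeomorphUnitInterval
      (stdSimplex.map i.succAbove (x : stdSimplex ℝ (Fin 1))) = if i = 0 then 1 else 0 := by
    intro i x
    obtain rfl : x = stdSimplex.vertex 0 := Subsingleton.elim _ _
    rw [stdSimplex.map_vertex]
    fin_cases i
    · exact stdSimplexHomeomorphUnitInterval_one
    · exact stdSimplexHomeomorphUnitInterval_zero
  have htδ : ∀ (i : Fin 2) (x), simplexMap ((singularSet Y).δ i (t x)) =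
      ContinuousMap.const _ (if i = 0 then simplexMap x default else y₀) := by
    intro i x
    ext z
    rw [simplexMap_δ]
    simp only [t, edgeOfCurve, simplexMap_simplexOfMap, ContinuousMap.comp_apply,
      ContinuousMap.coe_mk, hvertex]
    fin_cases i
    · exact (PathConnectedSpace.somePath y₀ _).target
    · exact (PathConnectedSpace.somePath y₀ _).source
  have ht0 : ∀ x, (singularSet Y).δ 0 (t x) = x := by
    intro x
    apply simplexMap_injective
    rw [htδ]
    ext z
    rw [Subsingleton.elim z default]
    rfl
  have ht1 : ∀ x, (singularSet Y).δ 1 (t x) = x₀ := by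
    intro x
    apply simplexMap_injective
    rw [htδ, simplexMap_simplexOfMap]
    rfl
  obtain ⟨f, hf⟩ := exists_cochain_of_isZero_homology (singularSet Y) h1 h2 x₀ t ht0 ht1 e hcocycle
  let F : (unitInterval → Y) → H := fun c =>
    if hc : Continuous c then ((f (edgeOfCurve ⟨c, hc⟩)).toMul : H) else 1
  have hF : ∀ γ : (singularSet Y) _⦋1⦌, F (edgeCurve γ ![0, 1]) = (f γ).toMul := by
    intro γ
    rw [show F (edgeCurve γ ![0, 1]) = _ from dif_pos (continuous_edgeCurve γ _),
      edgeOfCurve_edgeCurve]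
  have hFc : ∀ c, F c ∈ Subgroup.center H := by
    intro c
    simp only [F]
    split_ifs
    · exact Subtype.prop _
    · exact one_mem _
  -- Correcting the lift by the central primitive `F` of its defect gives a cocycle with the same
  -- image in the quotient.
  refine ⟨fun c => a c * (F c)⁻¹, ?_, fun c => ?_⟩
  · intro B g hB hg _ p hp q hq r hr
    obtain ⟨k1, k2, k3⟩ := edgeCurve_triangleOfMap hB hg hp hq hr
    generalize triangleOfMap hB hg hp hq hr = σ at *
    have s : ∀ i : Fin 3, i.succAbove ∘ (![0, 1] : Fin 2 → Fin 2) = ![i.succAbove 0, i.succAbove 1] :=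
      fun i => by ext k; fin_cases k <;> rfl
    have d0 := hF ((singularSet Y).δ 0 σ)
    have d1 := hF ((singularSet Y).δ 1 σ)
    have d2 := hF ((singularSet Y).δ 2 σ)
    rw [edgeCurve_δ, s] at d0 d1 d2
    change F (edgeCurve σ ![1, 2]) = _ at d0
    change F (edgeCurve σ ![0, 2]) = _ at d1
    change F (edgeCurve σ ![0, 1]) = _ at d2
    have hσ := he σ
    rw [hf σ, k1, k2, k3] at hσ
    simp only [toMul_add, toMul_sub, Subgroup.coe_mul, Subgroup.coe_div, ← d0, ← d1, ← d2, k1, k2,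
      k3] at hσ
    exact (mul_mul_inv_of_mem_center (hFc _) (hFc _) hσ).trans
      (Subgroup.mem_center_iff.1 (inv_mem (hFc _)) _).symm
  · rw [QuotientGroup.mk_mul, ha, QuotientGroup.mk_inv, (QuotientGroup.eq_one_iff _).2 (hFc c),
      inv_one, mul_one]

end Lifting

/-! ### Extending path cocycles from the knot exterior -/

/-- Path lifting for the covering `exp`; it supplies a continuous logarithm of the normal coordinate
along a curve that avoids the knot. -/
theorem exists_continuous_exp_eq {w : unitInterval → ℂ} (hw : Continuous w) (h0 : ∀ t, w t ≠ 0) :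
    ∃ v : unitInterval → ℂ, Continuous v ∧ ∀ t, Complex.exp (v t) = w t := by
  let γ : C(unitInterval, {z : ℂ // z ≠ 0}) := ⟨fun t => ⟨w t, h0 t⟩, by fun_prop⟩
  have hγ : γ 0 = ⟨_, (Complex.log (w 0)).exp_ne_zero⟩ :=
    Subtype.ext (Complex.exp_log (h0 0)).symm
  have h := Complex.isCoveringMap_exp.liftPath_lifts γ (Complex.log (w 0)) hγ
  refine ⟨_, (Complex.isCoveringMap_exp.liftPath γ (Complex.log (w 0)) hγ).continuous, fun t => ?_⟩
  exact congrArg Subtype.val (congrFun h t)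

namespace TubularNbhd

variable {Y : Type u} [TopologicalSpace Y] {K : Knot Y} (N : TubularNbhd K)

theorem mem_exterior_of_one_le_norm {p : Circle × ℂ} (h : 1 ≤ ‖p.2‖) : N.toFun p ∈ N.exterior := by
  rintro ⟨q, hq, he⟩
  rw [N.isOpenEmbedding.injective he] at hq
  exact absurd hq (not_lt.2 h)

theorem one_le_norm_radial {w : ℂ} (hw : w ≠ 0) : 1 ≤ ‖((max 1 ‖w‖⁻¹ : ℝ) : ℂ) * w‖ := by
  have h := norm_pos_iff.2 hw
  rw [norm_mul, Complex.norm_real, Real.norm_of_nonneg (by positivity)]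
  calc (1 : ℝ) = ‖w‖⁻¹ * ‖w‖ := (inv_mul_cancel₀ h.ne').symm
    _ ≤ _ := by gcongr; exact le_max_right _ _

open scoped Classical in
/-- The radial projection of the punctured neighborhood to the exterior. -/
def radial (p : Circle × ℂ) : N.exterior :=
  if h : p.2 = 0 then N.boundaryInclusion (1, 1) else
    ⟨N.toFun (p.1, ((max 1 ‖p.2‖⁻¹ : ℝ) : ℂ) * p.2),
      N.mem_exterior_of_one_le_norm (one_le_norm_radial h)⟩

theorem continuousOn_radial : ContinuousOn N.radial {p | p.2 ≠ 0} := by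
  rw [continuousOn_iff_continuous_domRestrict]
  have : Set.domRestrict {p : Circle × ℂ | p.2 ≠ 0} N.radial = fun p : {p : Circle × ℂ | p.2 ≠ 0} =>
      ⟨N.toFun (p.1.1, ((max 1 ‖p.1.2‖⁻¹ : ℝ) : ℂ) * p.1.2),
        N.mem_exterior_of_one_le_norm (one_le_norm_radial p.2)⟩ := by
    funext p
    exact dif_neg p.2
  rw [this]
  refine Continuous.subtype_mk (N.isOpenEmbedding.continuous.comp ?_) _
  have h : ∀ p : {p : Circle × ℂ | p.2 ≠ 0}, ‖p.1.2‖ ≠ 0 := fun p => norm_ne_zero_iff.2 p.2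
  fun_prop (disch := assumption)

theorem radial_of_one_le_norm {p : Circle × ℂ} (h : 1 ≤ ‖p.2‖) :
    N.radial p = ⟨N.toFun p, N.mem_exterior_of_one_le_norm h⟩ := by
  have h0 : p.2 ≠ 0 := norm_pos_iff.1 (by linarith)
  rw [radial, dif_neg h0]
  have : max 1 ‖p.2‖⁻¹ = 1 := max_eq_left (inv_le_one_of_one_le₀ h)
  simp [this]

theorem radial_coe (p : Circle × Circle) : N.radial (p.1, (p.2 : ℂ)) = N.boundaryInclusion p :=
  N.radial_of_one_le_norm (Circle.norm_coe p.2).ge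

open scoped Classical in
/-- The retraction of the complement of the knot to the exterior. -/
def retraction (y : Y) : N.exterior :=
  if h : y ∈ N.exterior then ⟨y, h⟩ else N.radial (Function.invFun N.toFun y)

theorem retraction_of_mem {y : Y} (h : y ∈ N.exterior) : N.retraction y = ⟨y, h⟩ := dif_pos h

theorem retraction_toFun (p : Circle × ℂ) : N.retraction (N.toFun p) = N.radial p := by
  by_cases h : N.toFun p ∈ N.exterior
  · rw [N.retraction_of_mem h, radial_of_one_le_norm]
    by_contra hp
    exact h ⟨p, not_le.1 hp, rfl⟩
  · rw [retraction, dif_neg h, Function.leftInverse_invFun N.isOpenEmbedding.injective]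

/-- The complement of the knot. -/
def complement : Set Y := (N.toFun '' {p | p.2 = 0})ᶜ

theorem toFun_mem_complement {p : Circle × ℂ} : N.toFun p ∈ N.complement ↔ p.2 ≠ 0 := by
  rw [complement, Set.mem_compl_iff, N.isOpenEmbedding.injective.mem_set_image]
  rfl

theorem exterior_subset_complement : N.exterior ⊆ N.complement :=
  Set.compl_subset_compl.2 (Set.image_mono fun p (hp : p.2 = 0) => by simp [hp])

theorem isClosed_image_closedDisk [T2Space Y] {ρ : ℝ} :
    IsClosed (N.toFun '' {p | ‖p.2‖ ≤ ρ}) := by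
  have : {p : Circle × ℂ | ‖p.2‖ ≤ ρ} = Set.univ ×ˢ Metric.closedBall 0 ρ := by
    ext p; simp
  rw [this]
  exact ((isCompact_univ.prod (isCompact_closedBall _ _)).image
    N.isOpenEmbedding.continuous).isClosed

theorem isOpen_complement [T2Space Y] : IsOpen N.complement := by
  rw [complement, isOpen_compl_iff]
  have : {p : Circle × ℂ | p.2 = 0} = {p | ‖p.2‖ ≤ 0} := by ext p; simp
  rw [this]
  exact N.isClosed_image_closedDisk

theorem isClosed_exterior : IsClosed N.exterior := by
  rw [exterior, isClosed_compl_iff]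
  exact N.isOpenEmbedding.isOpenMap _ (isOpen_lt (by fun_prop) continuous_const)

/-- Inside the tubular neighborhood the map is `radial` in coordinates. Elsewhere it is locally the
identity, because the closed disk bundle is compact and hence closed in the Hausdorff space `Y`. -/
theorem continuousOn_retraction [T2Space Y] : ContinuousOn N.retraction N.complement := by
  intro y hy
  refine ContinuousAt.continuousWithinAt ?_
  by_cases h : y ∈ Set.range N.toFun
  · obtain ⟨p, rfl⟩ := h
    rw [toFun_mem_complement] at hy
    rw [← N.isOpenEmbedding.continuousAt_iff]
    have : N.retraction ∘ N.toFun = N.radial := funext N.retraction_toFun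
    rw [this]
    exact N.continuousOn_radial.continuousAt
      ((isOpen_ne_fun continuous_snd continuous_const).mem_nhds hy)
  · rw [Topology.IsInducing.subtypeVal.continuousAt_iff]
    have hD : (N.toFun '' {p | ‖p.2‖ ≤ 1})ᶜ ∈ 𝓝 y :=
      N.isClosed_image_closedDisk.isOpen_compl.mem_nhds fun hy' => h (Set.image_subset_range _ _ hy')
    refine continuousAt_id.congr ?_
    filter_upwards [hD] with x hx
    have hx' : x ∈ N.exterior := by
      rintro ⟨p, hp, rfl⟩
      exact hx ⟨p, (le_of_lt hp : ‖p.2‖ ≤ 1), rfl⟩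
    rw [Function.comp_apply, N.retraction_of_mem hx']
    rfl

/-- The projection of the tubular neighborhood to the curve parallel to the knot. -/
def coreMap (y : Y) : N.exterior :=
  N.boundaryInclusion ((Function.invFun N.toFun y).1, 1)

theorem coreMap_toFun (p : Circle × ℂ) : N.coreMap (N.toFun p) = N.boundaryInclusion (p.1, 1) := by
  rw [coreMap, Function.leftInverse_invFun N.isOpenEmbedding.injective]

theorem continuousOn_coreMap : ContinuousOn N.coreMap (Set.range N.toFun) := by
  rintro _ ⟨p, rfl⟩
  refine ContinuousAt.continuousWithinAt ?_
  rw [← N.isOpenEmbedding.continuousAt_iff]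
  have : N.coreMap ∘ N.toFun = fun p => N.boundaryInclusion (p.1, 1) := funext N.coreMap_toFun
  rw [this]
  fun_prop

/-- The angular family of curves in the exterior. -/
def radialExp (z : Circle) (v : ℂ) : N.exterior := N.radial (z, Complex.exp v)

theorem continuous_radialExp : Continuous (Function.uncurry N.radialExp) :=
  N.continuousOn_radial.comp_continuous (f := fun p : Circle × ℂ => (p.1, Complex.exp p.2))
    (by fun_prop) fun p => Complex.exp_ne_zero _

theorem radialExp_periodic (z : Circle) (v : ℂ) :
    N.radialExp z (v + 2 * Real.pi * Complex.I) = N.radialExp z v := by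
  rw [radialExp, Complex.exp_periodic, radialExp]

theorem radialExp_zero (z : Circle) : N.radialExp z 0 = N.boundaryInclusion (z, 1) := by
  rw [← radial_coe]; simp [radialExp]

section Cocycle

variable {H : Type*} [Group H] {Φ : (unitInterval → N.exterior) → H}

/-- The value of a path cocycle on the image of a straight segment. -/
def radialPotential (Φ : (unitInterval → N.exterior) → H) (z : Circle) (v : ℂ) : H :=
  Φ fun t => N.radialExp z ((t : ℝ) * v)

/-- The square is swept by the segments from 0 to `v t`; at `s = 0` it traces the curve parallel to
the knot. -/
theorem radialPotential_homotopy (hΦ : IsPathCocycleOn Set.univ Φ) {z : unitInterval → Circle}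
    (hz : Continuous z) {v : unitInterval → ℂ} (hv : Continuous v) :
    Φ (fun t => N.radialExp (z t) (v t)) * N.radialPotential Φ (z 0) (v 0) =
      N.radialPotential Φ (z 1) (v 1) * Φ (fun t => N.boundaryInclusion (z t, 1)) := by
  have h := hΦ.square (g := fun s t => N.radialExp (z (Set.projIcc 0 1 zero_le_one t))
    ((s : ℂ) * v (Set.projIcc 0 1 zero_le_one t))) (by
      refine Continuous.continuousOn ?_
      have := N.continuous_radialExp
      unfold Function.uncurry at this ⊢
      exact this.comp (f := fun p : ℝ × ℝ => (z (Set.projIcc 0 1 zero_le_one p.2),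
        (p.1 : ℂ) * v (Set.projIcc 0 1 zero_le_one p.2))) (by fun_prop)) (fun _ _ _ _ => trivial)
  simpa [radialPotential, radialExp_zero] using h

/-- Sliding a meridian along the knot conjugates its value, so triviality over the point 1 spreads
to all fibres. -/
theorem angularLoop_eq_one (hΦ : IsPathCocycleOn Set.univ Φ)
    (hm : Φ (fun t => N.radialExp 1 ((t : ℝ) * (2 * Real.pi * Complex.I))) = 1) (z : Circle) :
    N.radialPotential Φ z (2 * Real.pi * Complex.I) = 1 := by
  obtain ⟨θ, rfl⟩ := Circle.exp_surjective z
  have h := N.radialPotential_homotopy hΦ (z := fun t => Circle.exp (t * θ)) (by fun_prop)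
    (v := fun _ => 2 * Real.pi * Complex.I) (by fun_prop)
  have e : ∀ z, N.radialExp z (2 * Real.pi * Complex.I) = N.boundaryInclusion (z, 1) := by
    intro z
    rw [← N.radialExp_zero, ← N.radialExp_periodic z 0, zero_add]
  simp only [e] at h
  have h1 : N.radialPotential Φ (Circle.exp ((0 : unitInterval) * θ)) (2 * Real.pi * Complex.I) = 1 := by
    simpa [radialPotential] using hm
  rw [h1, mul_one] at h
  simpa using (right_eq_mul.1 h)

/-- The two potentials differ by the value on a loop that winds once around the fibre through `exp
v`; by the square `h2` that loop is conjugate to the trivial meridian. -/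
theorem radialPotential_add (hΦ : IsPathCocycleOn Set.univ Φ)
    (hm : Φ (fun t => N.radialExp 1 ((t : ℝ) * (2 * Real.pi * Complex.I))) = 1) (z : Circle) (v : ℂ) :
    N.radialPotential Φ z (v + 2 * Real.pi * Complex.I) = N.radialPotential Φ z v := by
  have h1 := N.radialPotential_homotopy hΦ (z := fun _ => z) continuous_const
    (v := fun t => v + t * (2 * Real.pi * Complex.I)) (by fun_prop)
  have h2 := hΦ.square (g := fun s t => N.radialExp z (t * v + s * (2 * Real.pi * Complex.I))) (by
      refine Continuous.continuousOn ?_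
      have := N.continuous_radialExp
      unfold Function.uncurry at this ⊢
      exact this.comp (f := fun p : ℝ × ℝ => (z, p.2 * v + p.1 * (2 * Real.pi * Complex.I)))
        (by fun_prop)) (fun _ _ _ _ => trivial)
  simp only [Complex.ofReal_zero, Complex.ofReal_one, zero_mul, one_mul, zero_add, add_zero,
    radialExp_periodic] at h2
  have h3 := N.angularLoop_eq_one hΦ hm z
  simp only [radialPotential] at h3
  rw [h3, mul_one] at h2
  rw [right_eq_mul.1 h2, one_mul] at h1
  rw [hΦ.const (x := N.boundaryInclusion (z, 1)) trivial, mul_one] at h1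
  simpa using h1.symm

/-- The jump of the principal logarithm is a multiple of 2πi, which the potential does not see;
hence it depends on `exp v` alone. -/
theorem radialPotential_log (hΦ : IsPathCocycleOn Set.univ Φ)
    (hm : Φ (fun t => N.radialExp 1 ((t : ℝ) * (2 * Real.pi * Complex.I))) = 1) (z : Circle) (v : ℂ) :
    N.radialPotential Φ z (Complex.log (Complex.exp v)) = N.radialPotential Φ z v := by
  have hper : Function.Periodic (N.radialPotential Φ z) (2 * Real.pi * Complex.I) :=
    N.radialPotential_add hΦ hm z
  obtain ⟨n, hn⟩ := Complex.exp_eq_exp_iff_exists_int.1 (Complex.exp_log (Complex.exp_ne_zero v))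
  rw [hn]
  exact hper.int_mul n v

open scoped Classical in
/-- A path cocycle on the exterior that is trivial on the meridian extends, up to a change of gauge,
to the whole manifold. -/
theorem exists_extension_of_meridian [T2Space Y] (hΦ : IsPathCocycleOn Set.univ Φ)
    (hm : Φ (fun t => N.radialExp 1 ((t : ℝ) * (2 * Real.pi * Complex.I))) = 1) :
    ∃ (Ψ : (unitInterval → Y) → H) (κ : N.exterior → H), IsPathCocycleOn Set.univ Ψ ∧
      ∀ c : unitInterval → N.exterior, Continuous c →
        Ψ (fun t => c t) = (κ (c 1))⁻¹ * Φ c * κ (c 0) := by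
  -- This gauge moves points of the punctured neighborhood to the parallel curve, so that the
  -- cocycle pulled back by the retraction agrees on the overlap with the one pulled back by the
  -- core projection.
  let κ : Y → H := fun y => N.radialPotential Φ (Function.invFun N.toFun y).1
    (Complex.log (Function.invFun N.toFun y).2)
  have hκ : ∀ p, κ (N.toFun p) = N.radialPotential Φ p.1 (Complex.log p.2) := by
    intro p
    simp only [κ, Function.leftInverse_invFun N.isOpenEmbedding.injective _]
  let ΦU : (unitInterval → Y) → H := fun c =>
    (κ (c 1))⁻¹ * Φ (N.retraction ∘ c) * κ (c 0)
  let ΦV : (unitInterval → Y) → H := fun c => Φ (N.coreMap ∘ c)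
  have hU : IsPathCocycleOn N.complement ΦU :=
    (hΦ.comp N.continuousOn_retraction fun _ _ => trivial).gauge κ
  have hV : IsPathCocycleOn (Set.range N.toFun) ΦV :=
    hΦ.comp N.continuousOn_coreMap fun _ _ => trivial
  -- Along a curve in the overlap choose a continuous logarithm of the normal coordinate; the fan of
  -- segments then compares the two cocycles.
  have hUV : ∀ c, Continuous c → (∀ t, c t ∈ N.complement) → (∀ t, c t ∈ Set.range N.toFun) →
      ΦU c = ΦV c := by
    intro c hc h1 h2
    choose p hp using h2
    obtain rfl : c = N.toFun ∘ p := funext fun t => (hp t).symm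
    have hpc : Continuous p := N.isOpenEmbedding.isInducing.continuous_iff.2 hc
    obtain ⟨v, hv, hve⟩ := exists_continuous_exp_eq (w := fun t => (p t).2) (by fun_prop)
      fun t => N.toFun_mem_complement.1 (h1 t)
    have h := N.radialPotential_homotopy hΦ (z := fun t => (p t).1) (by fun_prop) hv
    have e1 : N.retraction ∘ N.toFun ∘ p = fun t => N.radialExp (p t).1 (v t) := by
      funext t
      simp [retraction_toFun, radialExp, hve]
    have e2 : N.coreMap ∘ N.toFun ∘ p = fun t => N.boundaryInclusion ((p t).1, 1) := by
      funext t
      simp [coreMap_toFun]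
    have e3 : ∀ t, κ ((N.toFun ∘ p) t) = N.radialPotential Φ (p t).1 (v t) := by
      intro t
      rw [Function.comp_apply, hκ, ← hve, N.radialPotential_log hΦ hm]
    simp only [ΦU, ΦV, e1, e2, e3]
    rw [mul_assoc, h, inv_mul_cancel_left]
  let Θ : (unitInterval → Y) → H := fun c => if ∀ t, c t ∈ N.complement then ΦU c else ΦV c
  have hΘU : ∀ c, (∀ t, c t ∈ N.complement) → Θ c = ΦU c := fun c hc => if_pos hc
  have hΘV : ∀ c, Continuous c → (∀ t, c t ∈ Set.range N.toFun) → Θ c = ΦV c := by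
    intro c hc h
    by_cases h1 : ∀ t, c t ∈ N.complement
    · rw [hΘU c h1, hUV c hc h1 h]
    · exact if_neg h1
  obtain ⟨Ψ, hΨ, hΨΘ⟩ := exists_isPathCocycleOn_univ (𝒰 := {N.complement, Set.range N.toFun})
    (Φ := Θ) (by
      rintro U (rfl | rfl)
      · exact N.isOpen_complement
      · exact N.isOpenEmbedding.isOpen_range) (fun y => by
      by_cases hy : y ∈ N.complement
      · exact ⟨_, Or.inl rfl, hy⟩
      · exact ⟨_, Or.inr rfl, Set.image_subset_range _ _ (not_not.1 hy)⟩) (by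
      rintro U (rfl | rfl)
      · exact hU.congr_on fun c _ h => hΘU c h
      · exact hV.congr_on hΘV)
  refine ⟨Ψ, fun x => κ x, hΨ, fun c hc => ?_⟩
  have hcU : ∀ t, (c t : Y) ∈ N.complement := fun t => N.exterior_subset_complement (c t).2
  rw [hΨΘ _ (Or.inl rfl) _ (by fun_prop) hcU, hΘU _ hcU]
  have : N.retraction ∘ (fun t => (c t : Y)) = c := funext fun t => N.retraction_of_mem (c t).2
  simp only [ΦU, this]

end Cocycle

end TubularNbhd

/-! ### Finite generation of the knot group -/

section FiniteGeneration

open Set UniformSpace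
open scoped Uniformity

variable {H : Type*} [Group H]

/-- A potential for a function on the curves in `W`. -/
def IsPotentialOn {Y : Type*} [TopologicalSpace Y] (Φ : (unitInterval → Y) → H) (W : Set Y)
    (P : Y → H) : Prop :=
  ∀ c, Continuous c → (∀ t, c t ∈ W) → Φ c = P (c 1) * (P (c 0))⁻¹

/-- Two potentials of the same function differ by a right factor that is constant along paths in the
common domain. -/
theorem IsPotentialOn.inv_mul_eq {Y : Type*} [TopologicalSpace Y] {Φ : (unitInterval → Y) → H}
    {V W : Set Y} {P Q : Y → H} (hP : IsPotentialOn Φ V P) (hQ : IsPotentialOn Φ W Q) {y z : Y}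
    (h : JoinedIn (V ∩ W) y z) : (P y)⁻¹ * Q y = (P z)⁻¹ * Q z := by
  obtain ⟨γ, hγ⟩ := h
  have h1 := hP γ γ.continuous fun t => (hγ t).1
  have h2 := hQ γ γ.continuous fun t => (hγ t).2
  rw [h1, γ.source, γ.target] at h2
  rw [eq_inv_mul_iff_mul_eq, ← mul_assoc, h2, inv_mul_cancel_right]

/-- In a chart ball integrate along segments from the center; the fan over a curve gives the
relation. -/
theorem IsPathCocycleOn.exists_isPotentialOn {Y E : Type*} [TopologicalSpace Y]
    [NormedAddCommGroup E] [NormedSpace ℝ E] [ChartedSpace E Y] {U : Set Y} (hU : IsOpen U)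
    {Φ : (unitInterval → Y) → H} (hΦ : IsPathCocycleOn U Φ) {x : Y} (hx : x ∈ U) :
    ∃ W : Set Y, IsOpen W ∧ x ∈ W ∧ ∃ P : Y → H, IsPotentialOn Φ W P := by
  let φ := chartAt E x
  have hxs : x ∈ φ.source := mem_chart_source E x
  have hT : IsOpen (φ.target ∩ φ.symm ⁻¹' U) := φ.isOpen_inter_preimage_symm hU
  obtain ⟨ε, hε, hball⟩ := Metric.isOpen_iff.1 hT (φ x)
    ⟨φ.map_source hxs, by rwa [mem_preimage, φ.left_inv hxs]⟩
  refine ⟨φ.source ∩ φ ⁻¹' Metric.ball (φ x) ε, φ.isOpen_inter_preimage Metric.isOpen_ball,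
    ⟨hxs, Metric.mem_ball_self hε⟩,
    fun y => Φ fun t => φ.symm (AffineMap.lineMap (φ x) (φ y) (t : ℝ)), fun c hc hcW => ?_⟩
  have hφc : Continuous fun t => φ (c t) :=
    φ.continuousOn.comp_continuous hc fun t => (hcW t).1
  have hmem : ∀ s ∈ Icc (0 : ℝ) 1, ∀ t : unitInterval,
      AffineMap.lineMap (φ x) (φ (c t)) s ∈ Metric.ball (φ x) ε := fun s hs t =>
    (convex_ball (φ x) ε).lineMap_mem (Metric.mem_ball_self hε) (hcW t).2 hs
  have h := hΦ.square (g := fun s t => φ.symm (AffineMap.lineMap (φ x)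
      (φ (c (projIcc 0 1 zero_le_one t))) s)) (by
    refine φ.continuousOn_symm.comp (f := fun p : ℝ × ℝ => AffineMap.lineMap (φ x)
      (φ (c (projIcc 0 1 zero_le_one p.2))) p.1) (Continuous.continuousOn ?_)
      fun p hp => (hball (hmem _ hp.1 _)).1
    have : Continuous fun p : ℝ × ℝ => φ (c (projIcc 0 1 zero_le_one p.2)) :=
      hφc.comp (by fun_prop)
    simp only [AffineMap.lineMap_apply_module]
    exact ((continuous_const.sub continuous_fst).smul continuous_const).add
      (continuous_fst.smul this)) (fun s hs t _ => (hball (hmem s hs _)).2)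
  simp only [AffineMap.lineMap_apply_one, AffineMap.lineMap_apply_zero, projIcc_val,
    projIcc_left, projIcc_right, φ.left_inv hxs] at h
  rw [hΦ.const hx, mul_one] at h
  rw [eq_mul_inv_iff_mul_eq]
  have e : (fun t => φ.symm (φ (c t))) = c := funext fun t => φ.left_inv (hcW t).1
  rw [e] at h
  exact h

/-- The values of a path cocycle on the loops in a compact subset of a manifold lie in a finitely
generated subgroup. -/
theorem IsPathCocycleOn.exists_finite_closure {Y E : Type*} [UniformSpace Y]
    [NormedAddCommGroup E] [NormedSpace ℝ E] [ChartedSpace E Y] [LocallyPathConnectedSpace Y]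
    {U C : Set Y} (hU : IsOpen U) {Φ : (unitInterval → Y) → H} (hΦ : IsPathCocycleOn U Φ)
    (hC : IsCompact C) (hCU : C ⊆ U) (x₀ : Y) :
    ∃ S : Set H, S.Finite ∧ ∀ c, Continuous c → (∀ t, c t ∈ C) → c 0 = x₀ → c 1 = x₀ →
      Φ c ∈ Subgroup.closure S := by
  classical
  choose W hWo hxW P' hP' using fun x : C => hΦ.exists_isPotentialOn (E := E) hU (hCU x.2)
  obtain ⟨V, hV, hVW⟩ := lebesgue_number_lemma hC hWo fun x hx => mem_iUnion.2 ⟨⟨x, hx⟩, hxW _⟩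
  choose i hi using fun x : C => hVW x x.2
  obtain ⟨V₁, hV₁, -, hVV₁⟩ := comp_symm_mem_uniformity_sets hV
  obtain ⟨V₂, hV₂, hsymm, hVV₂⟩ := comp_symm_mem_uniformity_sets hV₁
  -- Three `V₂`-steps make a `V`-step: if two `V₂`-small sets meet, each lies in the domain of the
  -- other's potential.
  have hV₂' : ∀ a b c d, (a, b) ∈ V₂ → (c, b) ∈ V₂ → (c, d) ∈ V₂ → (a, d) ∈ V := by
    intro a b c d h1 h2 h3
    refine hVV₁ ⟨c, hVV₂ ⟨b, h1, ?_⟩, hVV₂ ⟨d, h3, refl_mem_uniformity hV₂⟩⟩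
    exact hsymm.symm _ _ h2
  let P : C → Y → H := fun x => P' (i x)
  have hP : ∀ x : C, IsPotentialOn Φ (ball (x : Y) V) (P x) := fun x c hc hcW =>
    hP' _ c hc fun t => hi x (hcW t)
  let O : C → Set Y := fun x => pathComponentIn (interior (ball (x : Y) V₂)) x
  have hOo : ∀ x, IsOpen (O x) := fun x => isOpen_interior.pathComponentIn _
  have hxO : ∀ x : C, (x : Y) ∈ O x := fun x =>
    mem_pathComponentIn_self (mem_interior_iff_mem_nhds.2 (ball_mem_nhds _ hV₂))
  have hO₂ : ∀ x : C, ∀ y ∈ O x, ((x : Y), y) ∈ V₂ := fun x y hy =>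
    interior_subset (s := ball (x : Y) V₂) (pathComponentIn_subset hy)
  have hOV : ∀ x : C, O x ⊆ ball (x : Y) V := fun x y hy =>
    hV₂' x y x y (hO₂ x y hy) (hO₂ x y hy) (hO₂ x y hy)
  have hOV' : ∀ j k : C, (O j ∩ O k).Nonempty → O k ⊆ ball (j : Y) V := by
    rintro j k ⟨y, hj, hk⟩ z hz
    exact hV₂' j y k z (hO₂ j y hj) (hO₂ k y hk) (hO₂ k z hz)
  -- `O k` is path connected and lies in both domains, even though `O j ∩ O k` may be disconnected;
  -- so the transition element is one constant.
  have hconst : ∀ j k : C, ∀ y ∈ O j ∩ O k, ∀ z ∈ O j ∩ O k,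
      (P j y)⁻¹ * P k y = (P j z)⁻¹ * P k z := by
    intro j k y hy z hz
    refine (hP j).inv_mul_eq (hP k) (JoinedIn.mono
      ((isPathConnected_pathComponentIn
        (mem_interior_iff_mem_nhds.2 (ball_mem_nhds _ hV₂))).joinedIn y hy.2 z hz.2) ?_)
    exact subset_inter (hOV' j k ⟨y, hy⟩) (hOV k)
  obtain ⟨T, hT⟩ := hC.elim_finite_subcover O hOo fun x hx => mem_iUnion.2 ⟨⟨x, hx⟩, hxO _⟩
  let e : C → C → H := fun j k =>
    if h : (O j ∩ O k).Nonempty then (P j h.some)⁻¹ * P k h.some else 1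
  have he : ∀ j k : C, ∀ y ∈ O j ∩ O k, (P j y)⁻¹ * P k y = e j k := by
    intro j k y hy
    have h : (O j ∩ O k).Nonempty := ⟨y, hy⟩
    rw [show e j k = _ from dif_pos h]
    exact hconst j k y hy _ h.some_mem
  -- Generators: the finitely many transition constants, and the values at `x₀` that undo the final
  -- conjugation.
  let S : Set H := (fun p : C × C => e p.1 p.2) '' ((T : Set C) ×ˢ (T : Set C)) ∪
    (fun j => P j x₀) '' (T : Set C)
  have hSe : ∀ j ∈ T, ∀ k ∈ T, ∀ y ∈ O j ∩ O k, (P j y)⁻¹ * P k y ∈ Subgroup.closure S := by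
    intro j hj k hk y hy
    rw [he j k y hy]
    exact Subgroup.subset_closure (Or.inl ⟨(j, k), ⟨hj, hk⟩, rfl⟩)
  refine ⟨S, (((T.finite_toSet.prod T.finite_toSet).image _).union (T.finite_toSet.image _)),
    fun c hc hcC h0 h1 => ?_⟩
  let b : ℝ → Y := fun t => c (projIcc 0 1 zero_le_one t)
  have hb : Continuous b := by fun_prop
  have hbC : ∀ t, b t ∈ C := fun t => hcC _
  have hbT : ∀ t, ∃ j ∈ T, b t ∈ O j := fun t => by simpa using hT (hbC t)
  let F : ℝ → ℝ → H := fun x y => Φ fun t => b (AffineMap.lineMap x y (t : ℝ))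
  have hF : ∀ x y z, F y z * F x y = F x z := fun x y z =>
    hΦ.subdivide (J := univ) convex_univ hb.continuousOn (fun t _ => hCU (hbC t)) trivial trivial
      trivial
  obtain ⟨δ, hδ, hL⟩ := lebesgue_number_lemma_of_metric (s := Icc (0 : ℝ) 1)
    (c := fun j : T => b ⁻¹' O j) isCompact_Icc (fun j => (hOo j).preimage hb) (fun t _ => by
      obtain ⟨j, hj, h⟩ := hbT t
      exact mem_iUnion.2 ⟨⟨j, hj⟩, h⟩)
  -- Measured in local potentials, a short piece of the curve contributes a product of two
  -- transition constants; longer pieces are halved.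
  have key : ∀ n : ℕ, ∀ x ∈ Icc (0 : ℝ) 1, ∀ y ∈ Icc (0 : ℝ) 1, dist x y < 2 ^ n * δ →
      ∀ j ∈ T, ∀ k ∈ T, b x ∈ O j → b y ∈ O k →
        (P k (b y))⁻¹ * F x y * P j (b x) ∈ Subgroup.closure S := by
    intro n
    induction n with
    | zero =>
      intro x hx y hy hd j hj k hk hbx hby
      obtain ⟨l, hl⟩ := hL x hx
      have hy' : y ∈ Metric.ball x δ := by rw [Metric.mem_ball, dist_comm]; simpa using hd
      have hFl : F x y = P l (b y) * (P l (b x))⁻¹ := by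
        have := hP l (fun t => b (AffineMap.lineMap x y (t : ℝ))) (by fun_prop) (fun t => hOV l
          (hl ((convex_ball x δ).lineMap_mem (Metric.mem_ball_self hδ) hy' t.2)))
        simpa using this
      have h1 := hSe k hk l l.2 (b y) ⟨hby, hl hy'⟩
      have h2 := hSe l l.2 j hj (b x) ⟨hl (Metric.mem_ball_self hδ), hbx⟩
      rw [hFl]
      convert mul_mem h1 h2 using 1
      group
    | succ n ih =>
      intro x hx y hy hd j hj k hk hbx hby
      rw [pow_succ] at hd
      have hm : midpoint ℝ x y ∈ Icc (0 : ℝ) 1 := (convex_Icc 0 1).midpoint_mem hx hy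
      obtain ⟨l, hl, hbl⟩ := hbT (midpoint ℝ x y)
      have h1 := ih x hx _ hm (by rw [dist_left_midpoint]; norm_num; linarith) j hj l hl hbx hbl
      have h2 := ih _ hm y hy (by rw [dist_midpoint_right]; norm_num; linarith) l hl k hk hbl hby
      convert mul_mem h2 h1 using 1
      rw [← hF x (midpoint ℝ x y) y]
      group
  obtain ⟨n, hn⟩ := pow_unbounded_of_one_lt (dist (0 : ℝ) 1 / δ) one_lt_two
  rw [div_lt_iff₀ hδ] at hn
  have hb0 : b 0 = x₀ := by simp [b, h0]
  have hb1 : b 1 = x₀ := by simp [b, h1]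
  obtain ⟨j, hj, hbj⟩ := hbT 0
  have hfin := key n 0 (by simp) 1 (by simp) hn j hj j hj hbj (by rwa [hb1, ← hb0])
  have hPj : P j x₀ ∈ Subgroup.closure S := Subgroup.subset_closure (Or.inr ⟨j, hj, rfl⟩)
  have hFc : F 0 1 = Φ c := by
    simp only [F, b, AffineMap.lineMap_apply_module]
    simp
  rw [hb0, hb1, hFc] at hfin
  have := mul_mem (mul_mem hPj hfin) (inv_mem hPj)
  convert this using 1
  group

end FiniteGeneration

namespace TubularNbhd

variable {Y : Type u} [TopologicalSpace Y] {K : Knot Y} (N : TubularNbhd K)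

/-- Boundary points of the exterior have no Euclidean neighborhood in it, so the universal cocycle
is pulled back by the retraction to the open knot complement. The exterior is a compact subset
there. -/
theorem exteriorGroup_fg [T2Space Y] [CompactSpace Y] [ChartedSpace (EuclideanSpace ℝ (Fin 3)) Y] :
    Group.FG N.exteriorGroup := by
  have : LocallyPathConnectedSpace Y :=
    ChartedSpace.locallyPathConnectedSpace (EuclideanSpace ℝ (Fin 3)) Y
  let x₀ : N.exterior := N.boundaryInclusion (1, 1)
  have hΦ : IsPathCocycleOn N.complement (fun c => universalCocycle x₀ (N.retraction ∘ c)) :=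
    (isPathCocycleOn_universalCocycle x₀).comp N.continuousOn_retraction fun _ _ => trivial
  let _ : UniformSpace Y := uniformSpaceOfCompactR1
  obtain ⟨S, hS, h⟩ := hΦ.exists_finite_closure (E := EuclideanSpace ℝ (Fin 3))
    N.isOpen_complement N.isClosed_exterior.isCompact N.exterior_subset_complement (x₀ : Y)
  obtain ⟨a, ha⟩ := exists_universalCocycle_loop x₀
  refine (Group.fg_iff (G := N.exteriorGroup)).2 ⟨S, ?_, hS⟩
  refine (Subgroup.eq_top_iff' _).2 fun g => ?_
  obtain ⟨γ, hγ⟩ := Path.Homotopic.Quotient.mk_surjective (FundamentalGroup.toPath (a * g * a⁻¹))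
  have h1 := h (fun t => (γ t : Y)) (by fun_prop) (fun t => (γ t).2) (by simp) (by simp)
  have h2 : N.retraction ∘ (fun t => (γ t : Y)) = γ := funext fun t => N.retraction_of_mem (γ t).2
  simp only [h2] at h1
  rw [ha, hγ] at h1
  convert h1 using 1
  change g = a⁻¹ * (a * g * a⁻¹) * a
  group

end TubularNbhd

/-! ### Representations that are central on the meridian -/

theorem IsIntegerHomologyThreeSphere.pathConnectedSpace {Y : Type u} [TopologicalSpace Y]
    (hY : IsIntegerHomologyThreeSphere Y) : PathConnectedSpace Y := by
  obtain ⟨hch⟩ := hY.manifold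
  have := hY.connected
  have : LocallyPathConnectedSpace Y :=
    ChartedSpace.locallyPathConnectedSpace (EuclideanSpace ℝ (Fin 3)) Y
  exact pathConnectedSpace_iff_connectedSpace.2 inferInstance

namespace TubularNbhd

variable {Y : Type u} [TopologicalSpace Y] {K : Knot Y} (N : TubularNbhd K)

/-- Extension over the solid torus, as in van Kampen's theorem; `b` absorbs the change of base path
and of gauge. -/
theorem exists_cocycle_of_meridian [T2Space Y] {H : Type*} [Group H] (ρ : N.exteriorGroup →* H)
    (hm : ρ (N.peripheral N.meridian) = 1) :
    ∃ Ψ : (unitInterval → Y) → H, IsPathCocycleOn Set.univ Ψ ∧ ∃ b : H,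
      ∀ γ : Path (N.boundaryInclusion (1, 1)) (N.boundaryInclusion (1, 1)),
        Ψ (γ.map continuous_subtype_val) =
          b⁻¹ * ρ (FundamentalGroup.fromPath (Path.Homotopic.Quotient.mk γ)) * b := by
  let x₀ : N.exterior := N.boundaryInclusion (1, 1)
  obtain ⟨a, ha⟩ := exists_universalCocycle_loop x₀
  have hΦ : IsPathCocycleOn Set.univ fun c => ρ (universalCocycle x₀ c) :=
    (isPathCocycleOn_universalCocycle x₀).map ρ
  let μ : Path x₀ x₀ := (torusLoop 0 1).map N.boundaryInclusion.continuous
  have hμ : (fun t : unitInterval => N.radialExp 1 ((t : ℝ) * (2 * Real.pi * Complex.I))) = μ := by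
    funext t
    have : Complex.exp ((t : ℝ) * (2 * Real.pi * Complex.I)) =
        ((Circle.exp (2 * Real.pi * t) : Circle) : ℂ) := by
      rw [Circle.coe_exp]; push_cast; ring_nf
    rw [radialExp, this, radial_coe N (1, Circle.exp (2 * Real.pi * t))]
    simp [μ, torusLoop]
  have hm' : ρ (FundamentalGroup.fromPath (Path.Homotopic.Quotient.mk μ)) = 1 := hm
  obtain ⟨Ψ, κ, hΨ, h⟩ := N.exists_extension_of_meridian hΦ (by
    rw [hμ, ha, map_mul, map_mul, hm', mul_one, ← map_mul, inv_mul_cancel, map_one])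
  refine ⟨Ψ, hΨ, ρ a * κ x₀, fun γ => ?_⟩
  have h1 := h γ γ.continuous
  rw [ha γ, γ.source, γ.target, map_mul, map_mul, map_inv] at h1
  refine h1.trans ?_
  change (κ x₀)⁻¹ * _ * κ x₀ = _
  group

/-- The representation extends to π₁(Y), where it is trivial. -/
theorem eq_one_of_meridian [T2Space Y] (hcyc : IsSU2Cyclic Y) (ρ : N.exteriorGroup →* SU2)
    (hm : ρ (N.peripheral N.meridian) = 1) : ρ = 1 := by
  obtain ⟨Ψ, hΨ, b, hb⟩ := N.exists_cocycle_of_meridian ρ hm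
  ext1 g
  obtain ⟨γ, rfl⟩ := Path.Homotopic.Quotient.mk_surjective (FundamentalGroup.toPath g)
  have h1 := DFunLike.congr_fun (hcyc _ (hΨ.toHom _))
    (FundamentalGroup.fromPath (Path.Homotopic.Quotient.mk (γ.map continuous_subtype_val)))
  rw [hΨ.toHom_mk, hb, MonoidHom.one_apply, mul_eq_one_iff_eq_inv, inv_mul_eq_iff_eq_mul,
    mul_inv_cancel] at h1
  exact h1

/-- Modulo the center the representation extends to `Y`; the extension lifts back to SU(2), and the
lift is trivial by SU(2)-cyclicity. -/
theorem mem_center_of_meridian (hY : IsIntegerHomologyThreeSphere Y) (hcyc : IsSU2Cyclic Y)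
    (ρ : N.exteriorGroup →* SU2) (hm : ρ (N.peripheral N.meridian) ∈ Subgroup.center SU2)
    (g : N.exteriorGroup) : ρ g ∈ Subgroup.center SU2 := by
  have := hY.t2
  have := hY.pathConnectedSpace
  obtain ⟨Ψ, hΨ, b, hb⟩ := N.exists_cocycle_of_meridian
    ((QuotientGroup.mk' (Subgroup.center SU2)).comp ρ) ((QuotientGroup.eq_one_iff _).2 hm)
  obtain ⟨Ψ', hΨ', hlift⟩ := hΨ.exists_lift_center
    (hY.homology.isZero 1 (by norm_num) (by norm_num))
    (hY.homology.isZero 2 (by norm_num) (by norm_num))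
  obtain ⟨γ, rfl⟩ := Path.Homotopic.Quotient.mk_surjective (FundamentalGroup.toPath g)
  have h1 := DFunLike.congr_fun (hcyc _ (hΨ'.toHom _))
    (FundamentalGroup.fromPath (Path.Homotopic.Quotient.mk (γ.map continuous_subtype_val)))
  rw [hΨ'.toHom_mk, MonoidHom.one_apply] at h1
  have h2 := hb γ
  rw [← hlift, h1, QuotientGroup.mk_one, eq_comm, mul_eq_one_iff_eq_inv, inv_mul_eq_iff_eq_mul,
    mul_inv_cancel] at h2
  exact (QuotientGroup.eq_one_iff _).1 h2

end TubularNbhd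

/-! ### Characters with values in SU(2) -/

theorem diagSU2_add (a b : ℝ) : diagSU2 (a + b) = diagSU2 a * diagSU2 b := by
  apply Subtype.ext
  ext i j
  fin_cases i <;> fin_cases j <;>
    simp [diagSU2, ← Complex.exp_add] <;> ring_nf

theorem diagSU2_zero : diagSU2 0 = 1 := by
  have := diagSU2_add 0 0
  rw [add_zero] at this
  exact (right_eq_mul.1 this)

theorem coe_diagSU2_pi : (diagSU2 Real.pi : Matrix (Fin 2) (Fin 2) ℂ) = -1 := by
  ext i j
  fin_cases i <;> fin_cases j <;> simp [diagSU2, Complex.exp_neg]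

theorem diagSU2_two_pi_int (k : ℤ) : diagSU2 (2 * Real.pi * k) = 1 := by
  apply Subtype.ext
  have h : Complex.exp (2 * Real.pi * k * Complex.I) = 1 :=
    Complex.exp_eq_one_iff.2 ⟨k, by ring⟩
  ext i j
  fin_cases i <;> fin_cases j <;> simp [diagSU2, Complex.exp_neg, h]

theorem diagSU2_eq_one {x : ℚ} (h : diagSU2 (2 * Real.pi * x) = 1) : ∃ n : ℤ, (n : ℚ) = x := by
  have h1 := congrFun (congrFun (congrArg Subtype.val h) 0) 0
  simp only [diagSU2, Matrix.of_apply, Matrix.cons_val', Matrix.cons_val_zero,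
    OneMemClass.coe_one, Matrix.one_apply_eq] at h1
  obtain ⟨n, hn⟩ := Complex.exp_eq_one_iff.1 h1
  refine ⟨n, ?_⟩
  have h2 : ((2 * Real.pi * x : ℝ) : ℂ) = ((n * (2 * Real.pi) : ℝ) : ℂ) := by
    apply mul_right_cancel₀ Complex.I_ne_zero
    rw [hn]; push_cast; ring
  have h3 := Complex.ofReal_injective h2
  have h4 : (x : ℝ) = n := by
    have := Real.pi_pos
    field_simp at h3
    linarith
  exact_mod_cast h4.symm

/-- The embedding of `ℚ / ℤ` in `SU(2)`. -/
def rationalCircleSU2 : AddCircle (1 : ℚ) →+ Additive SU2 :=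
  QuotientAddGroup.lift (AddSubgroup.zmultiples (1 : ℚ))
    { toFun := fun x => Additive.ofMul (diagSU2 (2 * Real.pi * x))
      map_zero' := by simp [diagSU2_zero]
      map_add' := fun x y => by
        rw [← ofMul_mul, ← diagSU2_add]; push_cast; ring_nf }
    (by
      rintro _ ⟨n, rfl⟩
      have := diagSU2_two_pi_int n
      simpa using congrArg Additive.ofMul this)

theorem rationalCircleSU2_injective : Function.Injective rationalCircleSU2 := by
  rw [injective_iff_map_eq_zero]
  intro x hx
  induction x using QuotientAddGroup.induction_on with | _ x
  obtain ⟨n, rfl⟩ := diagSU2_eq_one (x := x) hx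
  exact (QuotientAddGroup.eq_zero_iff _).2 ⟨n, by simp⟩

/-- An element that is killed by every abelian `SU(2)`-representation that kills `m` is a power of
`m` modulo commutators. -/
theorem exists_mul_zpow_mem_commutator {G : Type*} [Group G] (m : G)
    (h : ∀ ρ : G →* SU2, ρ m = 1 → ρ = 1) (g : G) : ∃ n : ℤ, g * m ^ n ∈ commutator G := by
  let q : G →* Abelianization G ⧸ Subgroup.zpowers (Abelianization.of m) :=
    (QuotientGroup.mk' _).comp Abelianization.of
  have hq : q g = 1 := by
    by_contra hne
    -- Characters into ℚ/ℤ separate the points of an abelian group, and ℚ/ℤ embeds in the diagonal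
    -- torus of SU(2).
    obtain ⟨χ, hχ⟩ := CharacterModule.exists_character_apply_ne_zero_of_ne_zero
      (a := Additive.ofMul (q g)) (fun h0 => hne (ofMul_eq_zero.1 h0))
    let ρ : G →* SU2 :=
      { toFun := fun x => (rationalCircleSU2 (χ (Additive.ofMul (q x)))).toMul
        map_one' := by simp
        map_mul' := fun x y => by rw [map_mul, ofMul_mul, map_add, map_add, toMul_add] }
    have hρm : ρ m = 1 := by
      have : q m = 1 := (QuotientGroup.eq_one_iff _).2 (Subgroup.mem_zpowers _)
      simp [ρ, this]
    have h1 : rationalCircleSU2 (χ (Additive.ofMul (q g))) = 0 :=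
      DFunLike.congr_fun (h ρ hρm) g
    exact hχ (rationalCircleSU2_injective (h1.trans (map_zero _).symm))
  rw [show q g = QuotientGroup.mk (Abelianization.of g) from rfl, QuotientGroup.eq_one_iff] at hq
  obtain ⟨n, hn⟩ := hq
  refine ⟨-n, ?_⟩
  rw [← Abelianization.ker_of, MonoidHom.mem_ker, map_mul, map_zpow, zpow_neg]
  simp only at hn
  rw [hn, mul_inv_cancel]

/-! ### Irreducible representations near central ones -/

/-- By Schur's lemma every operator is scalar, so a coordinate line is a proper nonzero invariant
subspace. -/
theorem Representation.not_isIrreducible_of_commute {G : Type*} [Group G]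
    (ρ : Representation ℂ G (Fin 2 → ℂ)) (h : ∀ g k, ρ g * ρ k = ρ k * ρ g) :
    ¬ ρ.IsIrreducible := by
  intro hirr
  have hscalar : ∀ g, ∃ a : ℂ, ∀ v, ρ g v = a • v := by
    intro g
    let f : Representation.IntertwiningMap ρ ρ :=
      { ρ g with isIntertwining' := fun k => h g k }
    obtain ⟨a, ha⟩ :=
      Representation.IsIrreducible.algebraMap_intertwiningMap_bijective_of_isAlgClosed.2 f
    refine ⟨a, fun v => ?_⟩
    exact (congrArg (fun k : Representation.IntertwiningMap ρ ρ => k.toLinearMap v) ha).symm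
  let S : Subrepresentation ρ :=
    { toSubmodule := Submodule.span ℂ {Pi.single 0 1}
      apply_mem_toSubmodule := fun g v hv => by
        obtain ⟨a, ha⟩ := hscalar g
        rw [ha]
        exact Submodule.smul_mem _ _ hv }
  have e : (Pi.single 0 1 : Fin 2 → ℂ) ∈ S.toSubmodule := Submodule.mem_span_singleton_self _
  rcases eq_bot_or_eq_top S with hS | hS
  · rw [hS] at e
    have := congrFun ((Submodule.mem_bot ℂ).1 e) 0
    simp at this
  · have h1 : (Pi.single 1 1 : Fin 2 → ℂ) ∈ S.toSubmodule := by rw [hS]; trivial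
    obtain ⟨a, ha⟩ := Submodule.mem_span_singleton.1 h1
    have := congrFun ha 1
    simp at this

theorem SU2Hom.not_isIrreducible_of_commute {G : Type*} [Group G] (ρ : G →* SU2)
    (h : ∀ g k, ρ g * ρ k = ρ k * ρ g) : ¬ (SU2Hom.toRepresentation ρ).IsIrreducible := by
  refine Representation.not_isIrreducible_of_commute _ fun g k => ?_
  let f : SU2 →* Module.End ℂ (Fin 2 → ℂ) :=
    ((Matrix.toLinAlgEquiv' : Matrix (Fin 2) (Fin 2) ℂ ≃ₐ[ℂ] _) : _ →* _).comp
      (Matrix.specialUnitaryGroup (Fin 2) ℂ).subtype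
  change f (ρ g) * f (ρ k) = f (ρ k) * f (ρ g)
  rw [← map_mul f, h g k, map_mul]

/-! ### The bi-invariant operator-norm distance on SU(2). -/

section Norm

open scoped Matrix.Norms.L2Operator

theorem SU2.coe_mem_unitary (A : SU2) : (A : Matrix (Fin 2) (Fin 2) ℂ) ∈ unitary _ :=
  Matrix.specialUnitaryGroup_le_unitaryGroup A.2

theorem SU2.norm_coe_mul (A : SU2) (X : Matrix (Fin 2) (Fin 2) ℂ) :
    ‖(A : Matrix (Fin 2) (Fin 2) ℂ) * X‖ = ‖X‖ :=
  CStarRing.norm_mem_unitary_mul X (SU2.coe_mem_unitary A)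

theorem SU2.norm_mul_coe (A : SU2) (X : Matrix (Fin 2) (Fin 2) ℂ) :
    ‖X * (A : Matrix (Fin 2) (Fin 2) ℂ)‖ = ‖X‖ :=
  CStarRing.norm_mul_mem_unitary X (SU2.coe_mem_unitary A)

/-- The distance of two elements of `SU(2)` in the operator norm. -/
def SU2.opDist (A B : SU2) : ℝ :=
  ‖(A : Matrix (Fin 2) (Fin 2) ℂ) - (B : Matrix (Fin 2) (Fin 2) ℂ)‖

namespace SU2

theorem opDist_nonneg (A B : SU2) : 0 ≤ opDist A B := norm_nonneg _

theorem opDist_comm (A B : SU2) : opDist A B = opDist B A := norm_sub_rev _ _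

theorem opDist_self (A : SU2) : opDist A A = 0 := by simp [opDist]

theorem eq_of_opDist_eq_zero {A B : SU2} (h : opDist A B = 0) : A = B :=
  Subtype.ext (sub_eq_zero.1 (norm_eq_zero.1 h))

theorem opDist_triangle (A B C : SU2) : opDist A C ≤ opDist A B + opDist B C :=
  norm_sub_le_norm_sub_add_norm_sub _ _ _

theorem opDist_mul_left (A B C : SU2) : opDist (A * B) (A * C) = opDist B C := by
  rw [opDist, opDist, Submonoid.coe_mul, Submonoid.coe_mul, ← mul_sub, norm_coe_mul]

theorem opDist_mul_right (A B C : SU2) : opDist (B * A) (C * A) = opDist B C := by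
  rw [opDist, opDist, Submonoid.coe_mul, Submonoid.coe_mul, ← sub_mul, norm_mul_coe]

theorem opDist_mul_mul_le (A B C D : SU2) :
    opDist (A * B) (C * D) ≤ opDist A C + opDist B D := by
  refine (opDist_triangle _ (C * B) _).trans ?_
  rw [opDist_mul_right, opDist_mul_left]

theorem opDist_inv_inv (A B : SU2) : opDist A⁻¹ B⁻¹ = opDist A B := by
  rw [← opDist_mul_left A, ← opDist_mul_right B, mul_inv_cancel, one_mul, mul_assoc,
    inv_mul_cancel, mul_one, opDist_comm]

/-- A commutator is close to `1`, relative to the distance of its entries to powers of `M`. -/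
theorem opDist_commutator_le (A B M : SU2) (a b : ℤ) :
    opDist (A * B * A⁻¹ * B⁻¹) 1 ≤ 2 * opDist (M ^ a) 1 * opDist B (M ^ b) + 2 * opDist A (M ^ a) * opDist B 1 := by
  have h1 : opDist (A * B * A⁻¹ * B⁻¹) 1 = opDist (A * B) (B * A) := by
    rw [← opDist_mul_right (B * A) _ 1, one_mul]
    congr 1
    group
  have hcomm : ((M ^ a : SU2) : Matrix (Fin 2) (Fin 2) ℂ) * (M ^ b : SU2) =
      ((M ^ b : SU2) : Matrix (Fin 2) (Fin 2) ℂ) * (M ^ a : SU2) := by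
    rw [← Submonoid.coe_mul, ← Submonoid.coe_mul, ← zpow_add, ← zpow_add, add_comm]
  rw [h1]
  simp only [opDist, Submonoid.coe_mul, OneMemClass.coe_one]
  generalize ((M ^ a : SU2) : Matrix (Fin 2) (Fin 2) ℂ) = Ma at *
  generalize ((M ^ b : SU2) : Matrix (Fin 2) (Fin 2) ℂ) = Mb at *
  generalize (A : Matrix (Fin 2) (Fin 2) ℂ) = A at *
  generalize (B : Matrix (Fin 2) (Fin 2) ℂ) = B at *
  -- Since `Ma` and `Mb` commute, [A, B] = [Ma - 1, B - Mb] + [A - Ma, B - 1]; each bracket pairs a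
  -- distance to a power of `M` with a distance to 1.
  have e : A * B - B * A = ((Ma - 1) * (B - Mb) - (B - Mb) * (Ma - 1)) +
      ((A - Ma) * (B - 1) - (B - 1) * (A - Ma)) := by
    have : A * B - B * A - (((Ma - 1) * (B - Mb) - (B - Mb) * (Ma - 1)) +
      ((A - Ma) * (B - 1) - (B - 1) * (A - Ma))) = Ma * Mb - Mb * Ma := by noncomm_ring
    rw [hcomm, sub_self] at this
    exact sub_eq_zero.1 this
  rw [e]
  refine (norm_add_le _ _).trans (add_le_add ((norm_sub_le _ _).trans ?_)
    ((norm_sub_le _ _).trans ?_))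
  · have h1 := norm_mul_le (Ma - 1) (B - Mb)
    have h2 := norm_mul_le (B - Mb) (Ma - 1)
    linarith [mul_comm ‖Ma - 1‖ ‖B - Mb‖]
  · have h1 := norm_mul_le (A - Ma) (B - 1)
    have h2 := norm_mul_le (B - 1) (A - Ma)
    linarith [mul_comm ‖A - Ma‖ ‖B - 1‖]

/-- A function that vanishes exactly at `1` and `-1`. -/
def centralDist (A : SU2) : ℝ :=
  ‖(A : Matrix (Fin 2) (Fin 2) ℂ) - 1‖ * ‖(A : Matrix (Fin 2) (Fin 2) ℂ) + 1‖

theorem centralDist_nonneg (A : SU2) : 0 ≤ centralDist A := by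
  unfold centralDist; positivity

theorem centralDist_eq_zero {A : SU2} : centralDist A = 0 ↔
    (A : Matrix (Fin 2) (Fin 2) ℂ) = 1 ∨ (A : Matrix (Fin 2) (Fin 2) ℂ) = -1 := by
  rw [centralDist, mul_eq_zero, norm_eq_zero, norm_eq_zero, sub_eq_zero, add_eq_zero_iff_eq_neg]

theorem mem_center_of_centralDist_eq_zero {A : SU2} (h : centralDist A = 0) :
    A ∈ Subgroup.center SU2 := by
  rw [Subgroup.mem_center_iff]
  intro B
  apply Subtype.ext
  rw [Submonoid.coe_mul, Submonoid.coe_mul]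
  rcases centralDist_eq_zero.1 h with h | h <;> simp [h]

theorem centralDist_conj (u A : SU2) : centralDist (u * A * u⁻¹) = centralDist A := by
  have hu : (u : Matrix (Fin 2) (Fin 2) ℂ) * ((u⁻¹ : SU2) : Matrix (Fin 2) (Fin 2) ℂ) = 1 := by
    rw [← Submonoid.coe_mul, mul_inv_cancel, OneMemClass.coe_one]
  have h1 : ((u * A * u⁻¹ : SU2) : Matrix (Fin 2) (Fin 2) ℂ) - 1 =
      u * ((A : Matrix (Fin 2) (Fin 2) ℂ) - 1) * (u⁻¹ : SU2) := by
    rw [mul_sub, sub_mul, mul_one, hu, Submonoid.coe_mul, Submonoid.coe_mul]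
  have h2 : ((u * A * u⁻¹ : SU2) : Matrix (Fin 2) (Fin 2) ℂ) + 1 =
      u * ((A : Matrix (Fin 2) (Fin 2) ℂ) + 1) * (u⁻¹ : SU2) := by
    rw [mul_add, add_mul, mul_one, hu, Submonoid.coe_mul, Submonoid.coe_mul]
  rw [centralDist, h1, h2, norm_mul_coe, norm_mul_coe, norm_coe_mul, norm_coe_mul, centralDist]

theorem continuous_matrix_norm :
    @Continuous (Matrix (Fin 2) (Fin 2) ℂ) ℝ instTopologicalSpaceMatrix _ fun A => ‖A‖ :=
  continuous_norm

theorem isCompact_specialUnitaryGroup : @IsCompact _ instTopologicalSpaceMatrix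
    (Matrix.specialUnitaryGroup (Fin 2) ℂ : Set (Matrix (Fin 2) (Fin 2) ℂ)) := by
  have : ProperSpace (Matrix (Fin 2) (Fin 2) ℂ) := FiniteDimensional.proper ℂ _
  refine Metric.isCompact_of_isClosed_isBounded ?_ ?_
  · have : (Matrix.specialUnitaryGroup (Fin 2) ℂ : Set (Matrix (Fin 2) (Fin 2) ℂ)) =
        {A | A * star A = 1} ∩ {A | A.det = 1} := by
      ext A
      exact Matrix.mem_specialUnitaryGroup_iff.trans
        (and_congr_left' Matrix.mem_unitaryGroup_iff)
    rw [this]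
    exact (isClosed_eq (by fun_prop) continuous_const).inter
      (isClosed_eq (continuous_id.matrix_det) continuous_const)
  · refine (Metric.isBounded_closedBall (x := 0) (r := 1)).subset fun A hA => ?_
    rw [mem_closedBall_zero_iff]
    exact (CStarRing.norm_of_mem_unitary (Matrix.specialUnitaryGroup_le_unitaryGroup hA)).le

end SU2

end Norm

instance SU2.instCompactSpace : CompactSpace SU2 :=
  isCompact_iff_compactSpace.1 SU2.isCompact_specialUnitaryGroup

theorem SU2.continuous_opDist_right (B : SU2) : Continuous fun A => SU2.opDist A B :=
  SU2.continuous_matrix_norm.comp (continuous_subtype_val.sub continuous_const)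

theorem SU2.continuous_centralDist : Continuous SU2.centralDist :=
  (SU2.continuous_matrix_norm.comp (continuous_subtype_val.sub continuous_const)).mul
    (SU2.continuous_matrix_norm.comp (continuous_subtype_val.add continuous_const))

/-! ### Compactness of Hom(G, SU(2)) and rigidity near central representations. -/

section RepresentationSpace

variable {G : Type*} [Group G]

theorem SU2Hom.isInducing_coe : Topology.IsInducing (fun ρ : G →* SU2 => (ρ : G → SU2)) := ⟨rfl⟩

theorem SU2Hom.continuous_eval (g : G) : Continuous fun ρ : G →* SU2 => ρ g :=
  (continuous_apply g).comp SU2Hom.isInducing_coe.continuous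

/-- Multiplicativity is a closed condition in the product of copies of SU(2), which is compact by
Tychonoff. -/
instance SU2Hom.instCompactSpace : CompactSpace (G →* SU2) := by
  have hcl : IsClosed (Set.range fun ρ : G →* SU2 => (ρ : G → SU2)) := by
    have : (Set.range fun ρ : G →* SU2 => (ρ : G → SU2)) =
        ⋂ p : G × G, {f | f (p.1 * p.2) = f p.1 * f p.2} := by
      ext f
      simp only [Set.mem_range, Set.mem_iInter, Set.mem_ofPred_eq, Prod.forall]
      exact ⟨by rintro ⟨ρ, rfl⟩ a b; exact map_mul ρ a b, fun h => ⟨MonoidHom.mk' f h, rfl⟩⟩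
    rw [this]
    refine isClosed_iInter fun p => isClosed_eq (continuous_apply _) ?_
    exact (continuous_apply p.1).mul (continuous_apply p.2)
  exact (Topology.IsClosedEmbedding.mk ⟨SU2Hom.isInducing_coe, DFunLike.coe_injective⟩ hcl).compactSpace

open Filter SU2

theorem tendsto_opDist_eval (g : G) :
    Tendsto (fun ρ : G →* SU2 => opDist (ρ g) 1) (𝓝 1) (𝓝 0) := by
  have h : Continuous fun ρ : G →* SU2 => opDist (ρ g) 1 :=
    (continuous_opDist_right 1).comp (SU2Hom.continuous_eval g)
  exact h.tendsto' 1 0 (by rw [MonoidHom.one_apply, opDist_self])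

/-- In a word for `g`, erase the letters from `T`: by bi-invariance each costs at most the sum, and
a power of `m` remains. `C` and `a` depend on the word, not on `ρ`. -/
theorem exists_opDist_zpow_le {m : G} {T : Finset G}
    (hT : Subgroup.closure (insert m (T : Set G)) = ⊤) (g : G) :
    ∃ (C : ℝ) (a : ℤ), 0 ≤ C ∧ ∀ ρ : G →* SU2,
      opDist (ρ g) (ρ m ^ a) ≤ C * ∑ c ∈ T, opDist (ρ c) 1 := by
  have hg : g ∈ Subgroup.closure (insert m (T : Set G)) := hT ▸ Subgroup.mem_top g
  induction hg using Subgroup.closure_induction with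
  | mem x hx =>
    rcases hx with rfl | hx
    · exact ⟨0, 1, le_rfl, fun ρ => by simp [opDist_self]⟩
    · refine ⟨1, 0, zero_le_one, fun ρ => ?_⟩
      rw [zpow_zero, one_mul]
      exact Finset.single_le_sum (f := fun c => opDist (ρ c) 1) (fun c _ => opDist_nonneg _ _) hx
  | one => exact ⟨0, 0, le_rfl, fun ρ => by simp [opDist_self]⟩
  | mul x y _ _ hx hy =>
    obtain ⟨C, a, hC, h1⟩ := hx
    obtain ⟨D, b, hD, h2⟩ := hy
    refine ⟨C + D, a + b, add_nonneg hC hD, fun ρ => ?_⟩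
    rw [map_mul, zpow_add, add_mul]
    exact (opDist_mul_mul_le _ _ _ _).trans (add_le_add (h1 ρ) (h2 ρ))
  | inv x _ hx =>
    obtain ⟨C, a, hC, h1⟩ := hx
    refine ⟨C, -a, hC, fun ρ => ?_⟩
    rw [map_inv, zpow_neg, opDist_inv_inv]
    exact h1 ρ

/-- Each term of the commutator estimate has one factor bounded by the sum and one factor tending to
0 as ρ → 1, so the bound is of higher order than the sum. -/
theorem exists_tendsto_opDist_le_of_mem_commutator {m : G} {T : Finset G}
    (hT : Subgroup.closure (insert m (T : Set G)) = ⊤) {g : G} (hg : g ∈ commutator G) :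
    ∃ D : (G →* SU2) → ℝ, Tendsto D (𝓝 1) (𝓝 0) ∧ ∀ ρ : G →* SU2,
      opDist (ρ g) 1 ≤ D ρ * ∑ c ∈ T, opDist (ρ c) 1 := by
  rw [commutator_eq_closure] at hg
  induction hg using Subgroup.closure_induction with
  | mem x hx =>
    obtain ⟨g, k, rfl⟩ := hx
    obtain ⟨C, a, hC, h1⟩ := exists_opDist_zpow_le hT g
    obtain ⟨D, b, hD, h2⟩ := exists_opDist_zpow_le hT k
    refine ⟨fun ρ => 2 * D * opDist (ρ (m ^ a)) 1 + 2 * C * opDist (ρ k) 1, ?_, fun ρ => ?_⟩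
    · simpa using ((tendsto_opDist_eval (m ^ a)).const_mul (2 * D)).add
        ((tendsto_opDist_eval k).const_mul (2 * C))
    · simp only [commutatorElement_def, map_mul, map_inv, map_zpow]
      refine (opDist_commutator_le _ _ (ρ m) a b).trans ?_
      have e1 := mul_le_mul_of_nonneg_left (h2 ρ) (opDist_nonneg (ρ m ^ a) 1)
      have e2 := mul_le_mul_of_nonneg_right (h1 ρ) (opDist_nonneg (ρ k) 1)
      linarith
  | one => exact ⟨fun _ => 0, tendsto_const_nhds, fun ρ => by simp [opDist_self]⟩
  | mul x y _ _ hx hy =>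
    obtain ⟨D, hD, h1⟩ := hx
    obtain ⟨E, hE, h2⟩ := hy
    refine ⟨fun ρ => D ρ + E ρ, by simpa using hD.add hE, fun ρ => ?_⟩
    rw [map_mul, add_mul]
    have := opDist_mul_mul_le (ρ x) (ρ y) 1 1
    rw [one_mul] at this
    exact this.trans (add_le_add (h1 ρ) (h2 ρ))
  | inv x _ hx =>
    obtain ⟨D, hD, h1⟩ := hx
    refine ⟨D, hD, fun ρ => ?_⟩
    have := opDist_inv_inv (ρ x) 1
    rw [inv_one] at this
    rw [map_inv, this]
    exact h1 ρ

/-- Near the trivial representation, the image of a finitely generated group whose abelianization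
is generated by `m` is generated by the image of `m`. -/
theorem eventually_mem_zpowers [Group.FG G] {m : G}
    (hm : ∀ g : G, ∃ n : ℤ, g * m ^ n ∈ commutator G) :
    ∀ᶠ ρ : G →* SU2 in 𝓝 1, ∀ g, ρ g ∈ Subgroup.zpowers (ρ m) := by
  classical
  obtain ⟨S, hS⟩ := Group.fg_def.1 (inferInstance : Group.FG G)
  choose n hn using hm
  -- Multiplying the generators by powers of `m` puts them in the commutator subgroup.
  let T : Finset G := S.image fun s => s * m ^ n s
  have hT : Subgroup.closure (insert m (T : Set G)) = ⊤ := by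
    rw [eq_top_iff, ← hS, Subgroup.closure_le]
    intro s hs
    have h1 : m ∈ Subgroup.closure (insert m (T : Set G)) :=
      Subgroup.subset_closure (Set.mem_insert _ _)
    have h2 : s * m ^ n s ∈ Subgroup.closure (insert m (T : Set G)) :=
      Subgroup.subset_closure (Set.mem_insert_of_mem _
        (Finset.mem_coe.2 (Finset.mem_image_of_mem _ hs)))
    simpa using mul_mem h2 (inv_mem (zpow_mem h1 (n s)))
  have hTc : ∀ c ∈ T, c ∈ commutator G := by
    intro c hc
    obtain ⟨s, -, rfl⟩ := Finset.mem_image.1 hc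
    exact hn s
  choose! D hD hle using fun c (hc : c ∈ T) =>
    exists_tendsto_opDist_le_of_mem_commutator hT (hTc c hc)
  have hsum : Tendsto (fun ρ : G →* SU2 => ∑ c ∈ T, D c ρ) (𝓝 1) (𝓝 0) := by
    simpa using tendsto_finsetSum T fun c hc => hD c hc
  filter_upwards [hsum.eventually (gt_mem_nhds (show (0 : ℝ) < 1 / 2 by norm_num))] with ρ hρ g
  -- The elements of `T` are themselves in the commutator subgroup, so their sum is at most half of
  -- itself.
  have h0 : ∑ c ∈ T, opDist (ρ c) 1 = 0 := by
    have hnn : 0 ≤ ∑ c ∈ T, opDist (ρ c) 1 := Finset.sum_nonneg fun c _ => opDist_nonneg _ _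
    have h1 : ∑ c ∈ T, opDist (ρ c) 1 ≤ (∑ c ∈ T, D c ρ) * ∑ c ∈ T, opDist (ρ c) 1 := by
      rw [Finset.sum_mul]
      exact Finset.sum_le_sum fun c hc => hle c hc ρ
    nlinarith
  obtain ⟨C, a, -, h2⟩ := exists_opDist_zpow_le hT g
  have h3 := h2 ρ
  rw [h0, mul_zero] at h3
  rw [eq_of_opDist_eq_zero (le_antisymm h3 (opDist_nonneg _ _))]
  exact zpow_mem (Subgroup.mem_zpowers _) a

/-- Representations near a central one have commutative image. -/
theorem eventually_commute_of_central [Group.FG G] {m : G}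
    (hm : ∀ g : G, ∃ n : ℤ, g * m ^ n ∈ commutator G) {ρ₀ : G →* SU2}
    (h₀ : ∀ g, ρ₀ g ∈ Subgroup.center SU2) :
    ∀ᶠ ρ : G →* SU2 in 𝓝 ρ₀, ∀ g k, ρ g * ρ k = ρ k * ρ g := by
  have hc : ∀ g x, x * (ρ₀ g)⁻¹ = (ρ₀ g)⁻¹ * x := fun g x =>
    Subgroup.mem_center_iff.1 (inv_mem (h₀ g)) x
  -- Centrality of `ρ₀` makes the pointwise quotient a homomorphism; this moves `ρ₀` to the trivial
  -- representation.
  let Θ : (G →* SU2) → (G →* SU2) := fun ρ => MonoidHom.mk' (fun g => (ρ₀ g)⁻¹ * ρ g) fun g k => by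
    rw [map_mul, map_mul, mul_inv_rev, hc g, mul_assoc, mul_assoc, ← mul_assoc (ρ₀ k)⁻¹,
      ← hc k (ρ g), mul_assoc]
  have hΘ : Continuous Θ := SU2Hom.isInducing_coe.continuous_iff.2
    (continuous_pi fun g => continuous_const.mul (SU2Hom.continuous_eval g))
  have hΘ₀ : Θ ρ₀ = 1 := by
    ext1 g
    exact inv_mul_cancel _
  have h := (hΘ.tendsto ρ₀).eventually (hΘ₀ ▸ eventually_mem_zpowers hm)
  filter_upwards [h] with ρ hρ g k
  obtain ⟨a, ha⟩ := hρ g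
  obtain ⟨b, hb⟩ := hρ k
  have e : ∀ g, ρ g = ρ₀ g * Θ ρ g := fun g => (mul_inv_cancel_left _ _).symm
  have c₀ : ∀ g x, x * ρ₀ g = ρ₀ g * x := fun g x => Subgroup.mem_center_iff.1 (h₀ g) x
  have hcomm : Θ ρ g * Θ ρ k = Θ ρ k * Θ ρ g := by
    rw [← ha, ← hb]
    exact (zpow_mul_comm _ _ _)
  rw [e g, e k, mul_assoc, ← mul_assoc (Θ ρ g), c₀ k, mul_assoc, hcomm, mul_assoc,
    ← mul_assoc (Θ ρ k), c₀ g, mul_assoc, ← mul_assoc, ← mul_assoc, c₀ k]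
  simp only [mul_assoc]

end RepresentationSpace

end

/-! ### Compactness argument for the neighborhood of the two lines. -/

theorem mainTheorem9 {Y : Type u} [TopologicalSpace Y]
    (hY : IsIntegerHomologyThreeSphere Y) (hcyc : IsSU2Cyclic Y)
    (K : Knot Y) (N : TubularNbhd K)
    (l : TorusGroup) (hl : N.IsLongitude l) :
    ∃ U : Set Pillowcase, IsOpen U ∧
      Pillowcase.line N.meridian l 0 ∪ Pillowcase.line N.meridian l Real.pi ⊆ U ∧
      Disjoint U (N.toPillowcase '' RepSpace.irreducibles N.exteriorGroup) := by
  have := hY.t2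
  have := hY.compact
  obtain ⟨hch⟩ := hY.manifold
  have hfg : Group.FG N.exteriorGroup := N.exteriorGroup_fg
  let m : N.exteriorGroup := N.peripheral N.meridian
  -- A compact set that contains every irreducible representation, and on which the meridian is
  -- never ±1.
  let F : Set (N.exteriorGroup →* SU2) := (interior {ρ | ∀ g k, ρ g * ρ k = ρ k * ρ g})ᶜ
  have hF : IsCompact F := isOpen_interior.isClosed_compl.isCompact
  have hpos : ∀ ρ ∈ F, 0 < SU2.centralDist (ρ m) := by
    intro ρ hρ
    refine (SU2.centralDist_nonneg _).lt_of_ne' fun h0 => hρ ?_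
    rw [mem_interior_iff_mem_nhds]
    exact eventually_commute_of_central
      (exists_mul_zpow_mem_commutator m fun ρ h => N.eq_one_of_meridian hcyc ρ h)
      (N.mem_center_of_meridian hY hcyc ρ (SU2.mem_center_of_centralDist_eq_zero h0))
  obtain ⟨ε, hε, hle⟩ : ∃ ε > 0, ∀ ρ ∈ F, ε ≤ SU2.centralDist (ρ m) := by
    rcases F.eq_empty_or_nonempty with h | h
    · exact ⟨1, one_pos, by simp [h]⟩
    · obtain ⟨ρ, hρ, hmin⟩ := hF.exists_isMinOn h
        (SU2.continuous_centralDist.comp (SU2Hom.continuous_eval m)).continuousOn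
      exact ⟨_, hpos ρ hρ, fun σ hσ => hmin hσ⟩
  -- Conjugation invariance makes the distance of the meridian from ±1 a continuous function on the
  -- pillowcase; `U` is a sublevel set of it.
  let τ : Pillowcase → ℝ := Quotient.lift
    (fun σ : TorusGroup →* SU2 => SU2.centralDist (σ N.meridian)) (by
      rintro σ σ' ⟨w, hw⟩
      simp only [hw, SU2.centralDist_conj])
  have hτ : Continuous τ := Continuous.quotient_lift
    (SU2.continuous_centralDist.comp (SU2Hom.continuous_eval _)) _
  refine ⟨{x | τ x < ε}, isOpen_lt hτ continuous_const, ?_, ?_⟩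
  · have key : ∀ a, SU2.centralDist (diagSU2 a) = 0 → ∀ x ∈ Pillowcase.line N.meridian l a,
        τ x < ε := by
      rintro a ha _ ⟨α, β, ⟨σ, rfl, hσ, -⟩, k, rfl⟩
      change SU2.centralDist (σ N.meridian) < ε
      rwa [hσ, diagSU2_add, diagSU2_two_pi_int, mul_one, ha]
    rintro x (hx | hx)
    · exact key 0 (SU2.centralDist_eq_zero.2 (Or.inl (by rw [diagSU2_zero]; rfl))) x hx
    · exact key Real.pi (SU2.centralDist_eq_zero.2 (Or.inr coe_diagSU2_pi)) x hx
  · rw [Set.disjoint_right]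
    rintro _ ⟨_, ⟨ρ, hρ, rfl⟩, rfl⟩ (hlt : SU2.centralDist (ρ m) < ε)
    exact absurd (hle ρ fun hint => SU2Hom.not_isIrreducible_of_commute ρ
      (interior_subset hint) hρ) (not_le.2 hlt)
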